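/- Let $\alpha,\beta\in\mathbb C$ satisfy $\alpha+n+m\beta\neq 0$ for all nonzero integers $m,n$. Let $\mathcal L$ be the extended Heisenberg--Virasoro algebra with parameters $\alpha,\beta$ and $F=0$, i.e. the complex Lie algebra with basis $L_m,J_m,G_m$ ($m\in\mathbb Z$), $C_1,C_2,C_3$, where $C_1,C_2,C_3$ are central and, for $m,n\in\mathbb Z$, $$[L_m,L_n]=(m-n)L_{m+n}+\tfrac{m^3-m}{12}\delta_{m+n,0}C_1,\qquad [L_m,J_n]=-nJ_{m+n}-(m^2+m)\delta_{m+n,0}C_2,$$ $$[J_m,J_n]=m\,\delta_{m+n,0}C_3,\qquad [L_m,G_n]=-(\alpha+n+m\beta)G_{m+n},\qquad [J_m,G_n]=0,\qquad [G_m,G_n]=0.$$ For integers $d_1,d_2\ge 0$ and $\underline d=(d_1,d_2)$ let $\mathcal L_{\underline d}$ be the Lie subalgebra of $\mathcal L$ spanned by $G_{-d_1+i}$, $J_{-d_2+i}$, $L_i$ ($i\ge 0$) and $C_1,C_2,C_3$. Let $V$ be a simple $\mathcal L_{\underline d}$-module on which $C_3$ acts as a nonzero scalar. Suppose that there is an integer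 $k\ge 0$ such that (a) $G_k$ acts injectively on $V$, and (b) $G_{k+i}V=J_{d_2+i}V=L_{k+d_1+i}V=0$ for all integers $i\ge 1$. Then the induced module $\mathrm{Ind}_{\mathcal L_{\underline d}}^{\mathcal L}(V)=U(\mathcal L)\otimes_{U(\mathcal L_{\underline d})}V$ is a simple $\mathcal L$-module. -/

import Mathlib

open scoped TensorProduct

/-! ### Induced modules over Lie algebras -/

attribute [local instance 100] LieRing.ofAssociativeRing in
/-- The algebra map `U(𝔥) → U(𝔤)` coming from the inclusion of a Lie subalgebra `𝔥` of `𝔤`. -/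
noncomputable def LieSubalgebra.envelopingMap {R 𝔤 : Type*} [CommRing R] [LieRing 𝔤]
    [LieAlgebra R 𝔤] (𝔥 : LieSubalgebra R 𝔤) :
    UniversalEnvelopingAlgebra R 𝔥 →ₐ[R] UniversalEnvelopingAlgebra R 𝔤 :=
  UniversalEnvelopingAlgebra.lift R ((UniversalEnvelopingAlgebra.ι R).comp 𝔥.incl)

/-- The action of `U(𝔥)` on an `𝔥`-module `V`. -/
noncomputable def LieModule.envelopingAction (R 𝔥 V : Type*) [CommRing R] [LieRing 𝔥]
    [LieAlgebra R 𝔥] [AddCommGroup V] [Module R V] [LieRingModule 𝔥 V] [LieModule R 𝔥 V] :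
    UniversalEnvelopingAlgebra R 𝔥 →ₐ[R] Module.End R V :=
  UniversalEnvelopingAlgebra.lift R (LieModule.toEnd R 𝔥 V)

section Induced

variable {R 𝔤 : Type*} [CommRing R] [LieRing 𝔤] [LieAlgebra R 𝔤] (𝔥 : LieSubalgebra R 𝔤)
  (V : Type*) [AddCommGroup V] [Module R V] [LieRingModule 𝔥 V] [LieModule R 𝔥 V]

/-- The `U(𝔤)`-submodule of `U(𝔤) ⊗[R] V` generated by the elements `u y ⊗ v - u ⊗ y v`
with `u ∈ U(𝔤)`, `y ∈ U(𝔥)`, `v ∈ V`. -/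
noncomputable def LieModule.balancedRelations :
    Submodule (UniversalEnvelopingAlgebra R 𝔤) (UniversalEnvelopingAlgebra R 𝔤 ⊗[R] V) :=
  Submodule.span _ {t | ∃ (u : UniversalEnvelopingAlgebra R 𝔤)
    (y : UniversalEnvelopingAlgebra R 𝔥) (v : V),
    t = (u * 𝔥.envelopingMap y) ⊗ₜ[R] v - u ⊗ₜ[R] (LieModule.envelopingAction R 𝔥 V y v)}

/-- The induced module `U(𝔤) ⊗_{U(𝔥)} V`. -/
def LieModule.Ind : Type _ :=
  (UniversalEnvelopingAlgebra R 𝔤 ⊗[R] V) ⧸ LieModule.balancedRelations 𝔥 V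

namespace LieModule.Ind

noncomputable instance : AddCommGroup (LieModule.Ind 𝔥 V) :=
  inferInstanceAs (AddCommGroup
    ((UniversalEnvelopingAlgebra R 𝔤 ⊗[R] V) ⧸ LieModule.balancedRelations 𝔥 V))

noncomputable instance : Module (UniversalEnvelopingAlgebra R 𝔤) (LieModule.Ind 𝔥 V) :=
  inferInstanceAs (Module (UniversalEnvelopingAlgebra R 𝔤)
    ((UniversalEnvelopingAlgebra R 𝔤 ⊗[R] V) ⧸ LieModule.balancedRelations 𝔥 V))

noncomputable instance : Module R (LieModule.Ind 𝔥 V) :=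
  inferInstanceAs (Module R
    ((UniversalEnvelopingAlgebra R 𝔤 ⊗[R] V) ⧸ LieModule.balancedRelations 𝔥 V))

instance : IsScalarTower R (UniversalEnvelopingAlgebra R 𝔤) (LieModule.Ind 𝔥 V) :=
  inferInstanceAs (IsScalarTower R (UniversalEnvelopingAlgebra R 𝔤)
    ((UniversalEnvelopingAlgebra R 𝔤 ⊗[R] V) ⧸ LieModule.balancedRelations 𝔥 V))

/-- `𝔤` acts through `U(𝔤)`, that is, by left multiplication on the first tensor factor. -/
noncomputable instance : LieRingModule 𝔤 (LieModule.Ind 𝔥 V) where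
  bracket x w := UniversalEnvelopingAlgebra.ι R x • w
  add_lie x y w := by
    change UniversalEnvelopingAlgebra.ι R (x + y) • w = _
    rw [map_add, add_smul]
  lie_add x v w := smul_add _ _ _
  leibniz_lie x y w := by
    change UniversalEnvelopingAlgebra.ι R x • UniversalEnvelopingAlgebra.ι R y • w =
      UniversalEnvelopingAlgebra.ι R ⁅x, y⁆ • w +
        UniversalEnvelopingAlgebra.ι R y • UniversalEnvelopingAlgebra.ι R x • w
    let _ : LieRing (UniversalEnvelopingAlgebra R 𝔤) := LieRing.ofAssociativeRing
    rw [LieHom.map_lie, LieRing.of_associative_ring_bracket, sub_smul, mul_smul, mul_smul,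
      sub_add_cancel]

instance : LieModule R 𝔤 (LieModule.Ind 𝔥 V) where
  smul_lie r x w := by
    change UniversalEnvelopingAlgebra.ι R (r • x) • w = r • UniversalEnvelopingAlgebra.ι R x • w
    rw [map_smul, smul_assoc]
  lie_smul r x w := by
    change UniversalEnvelopingAlgebra.ι R x • r • w = r • UniversalEnvelopingAlgebra.ι R x • w
    rw [← algebraMap_smul (UniversalEnvelopingAlgebra R 𝔤) r w,
      ← algebraMap_smul (UniversalEnvelopingAlgebra R 𝔤) r
        (UniversalEnvelopingAlgebra.ι R x • w), ← mul_smul, ← mul_smul, Algebra.commutes]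

end LieModule.Ind

end Induced

/-! ### The extended Heisenberg-Virasoro algebra -/

/-- Labels of the basis `L_m, J_m, G_m` (`m ∈ ℤ`), `C₁, C₂, C₃`. -/
inductive EHVIndex : Type
  | L (m : ℤ)
  | J (m : ℤ)
  | G (m : ℤ)
  | C₁
  | C₂
  | C₃

/-- The underlying vector space of the extended Heisenberg-Virasoro algebra with parameters
`α, β, F`: the complex vector space with basis `L_m, J_m, G_m, C₁, C₂, C₃`. -/
def EHV (_α _β _F : ℂ) : Type := EHVIndex →₀ ℂ

namespace EHV

noncomputable instance (α β F : ℂ) : AddCommGroup (EHV α β F) :=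
  inferInstanceAs (AddCommGroup (EHVIndex →₀ ℂ))

noncomputable instance (α β F : ℂ) : Module ℂ (EHV α β F) :=
  inferInstanceAs (Module ℂ (EHVIndex →₀ ℂ))

/-- The basis of `EHV α β F` indexed by `EHVIndex`. -/
noncomputable def basis (α β F : ℂ) : Module.Basis EHVIndex ℂ (EHV α β F) :=
  Module.Basis.ofRepr (LinearEquiv.refl ℂ (EHVIndex →₀ ℂ))

section

variable (α β F : ℂ)

/-- The basis vector `L_m`. -/
noncomputable def L (m : ℤ) : EHV α β F := basis α β F (.L m)

/-- The basis vector `J_m`. -/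
noncomputable def J (m : ℤ) : EHV α β F := basis α β F (.J m)

/-- The basis vector `G_m`. -/
noncomputable def G (m : ℤ) : EHV α β F := basis α β F (.G m)

/-- The central basis vector `C₁`. -/
noncomputable def C₁ : EHV α β F := basis α β F .C₁

/-- The central basis vector `C₂`. -/
noncomputable def C₂ : EHV α β F := basis α β F .C₂

/-- The central basis vector `C₃`. -/
noncomputable def C₃ : EHV α β F := basis α β F .C₃

/-- The Lie brackets of the basis vectors. -/
noncomputable def basisBracket : EHVIndex → EHVIndex → EHV α β F
  | .L m, .L n => ((m : ℂ) - n) • L α β F (m + n) +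
      (if m + n = 0 then ((m : ℂ) ^ 3 - m) / 12 else 0) • C₁ α β F
  | .L m, .J n => (-(n : ℂ)) • J α β F (m + n) -
      (if m + n = 0 then (m : ℂ) ^ 2 + m else 0) • C₂ α β F
  | .J n, .L m => (n : ℂ) • J α β F (m + n) +
      (if m + n = 0 then (m : ℂ) ^ 2 + m else 0) • C₂ α β F
  | .L m, .G n => (-(α + n + m * β)) • G α β F (m + n)
  | .G n, .L m => (α + n + m * β) • G α β F (m + n)
  | .J m, .J n => (if m + n = 0 then (m : ℂ) else 0) • C₃ α β F
  | .J m, .G n => F • G α β F (m + n)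
  | .G n, .J m => (-F) • G α β F (m + n)
  | _, _ => 0

/-- The bilinear extension of the brackets of the basis vectors. -/
noncomputable def bracketMap : EHV α β F →ₗ[ℂ] EHV α β F →ₗ[ℂ] EHV α β F :=
  (basis α β F).constr ℂ fun a => (basis α β F).constr ℂ fun b => basisBracket α β F a b

noncomputable instance : Bracket (EHV α β F) (EHV α β F) where
  bracket x y := bracketMap α β F x y

theorem lie_basis (a b : EHVIndex) :
    ⁅basis α β F a, basis α β F b⁆ = basisBracket α β F a b := by
  change bracketMap α β F _ _ = _
  simp [bracketMap]

theorem bracketMap_basis (a b : EHVIndex) :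
    bracketMap α β F (basis α β F a) (basis α β F b) = basisBracket α β F a b := by
  simp [bracketMap]

theorem basisBracket_skew (a b : EHVIndex) :
    basisBracket α β F a b = -basisBracket α β F b a := by
  rcases a with m | m | m | _ | _ | _ <;> rcases b with n | n | n | _ | _ | _ <;>
    simp only [basisBracket, neg_zero]
  all_goals try rw [add_comm n m]
  all_goals
    by_cases h : m + n = 0
    · obtain rfl : n = -m := by omega
      try simp only [h, if_true]
      push_cast
      module
    · try simp only [h, if_false]
      module

theorem bracketMap_self (x : EHV α β F) : bracketMap α β F x x = 0 := by
  have h : bracketMap α β F = -(bracketMap α β F).flip := by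
    refine (basis α β F).ext fun a => (basis α β F).ext fun b => ?_
    simp only [LinearMap.neg_apply, LinearMap.flip_apply, bracketMap_basis]
    exact basisBracket_skew α β F a b
  have hx := LinearMap.congr_fun (LinearMap.congr_fun h x) x
  simp only [LinearMap.neg_apply, LinearMap.flip_apply] at hx
  have h2 : (2 : ℂ) • bracketMap α β F x x = 0 := by
    rw [two_smul]
    exact add_eq_zero_iff_eq_neg.mpr hx
  exact (smul_eq_zero.mp h2).resolve_left two_ne_zero

theorem bracketMap_leibniz_basis (a b c : EHVIndex) :
    bracketMap α β F (basis α β F a) (basisBracket α β F b c) =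
      bracketMap α β F (basisBracket α β F a b) (basis α β F c) +
        bracketMap α β F (basis α β F b) (basisBracket α β F a c) := by
  rcases a with m | m | m | _ | _ | _ <;> rcases b with n | n | n | _ | _ | _ <;>
    rcases c with p | p | p | _ | _ | _ <;>
    simp only [basisBracket, L, J, G, C₁, C₂, C₃, map_add, map_sub, map_smul, map_zero,
      LinearMap.add_apply, LinearMap.sub_apply, LinearMap.smul_apply, LinearMap.zero_apply,
      bracketMap_basis, smul_zero, add_zero, sub_zero, zero_add]
  all_goals try simp only [show m + (n + p) = m + n + p by ring, show m + (p + n) = m + n + p by ring,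
      show n + (m + p) = m + n + p by ring, show n + (p + m) = m + n + p by ring,
      show p + (m + n) = m + n + p by ring, show p + (n + m) = m + n + p by ring,
      show m + p + n = m + n + p by ring, show n + m + p = m + n + p by ring,
      show n + p + m = m + n + p by ring, show p + m + n = m + n + p by ring,
      show p + n + m = m + n + p by ring]
  all_goals
    by_cases h : m + n + p = 0
    · obtain rfl : p = -m - n := by omega
      try simp only [h, if_true]
      push_cast
      module
    · try simp only [h, if_false]
      push_cast
      module

theorem bracketMap_leibniz (x y z : EHV α β F) :
    bracketMap α β F x (bracketMap α β F y z) =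
      bracketMap α β F (bracketMap α β F x y) z +
        bracketMap α β F y (bracketMap α β F x z) := by
  let B := bracketMap α β F
  have h₁ (a b : EHVIndex) (z : EHV α β F) : B (basis α β F a) (B (basis α β F b) z) =
      B (B (basis α β F a) (basis α β F b)) z + B (basis α β F b) (B (basis α β F a) z) := by
    have : B (basis α β F a) ∘ₗ B (basis α β F b) =
        B (B (basis α β F a) (basis α β F b)) + B (basis α β F b) ∘ₗ B (basis α β F a) := by
      refine (basis α β F).ext fun c => ?_
      simp only [LinearMap.comp_apply, LinearMap.add_apply, B, bracketMap_basis]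
      exact bracketMap_leibniz_basis α β F a b c
    exact LinearMap.congr_fun this z
  have h₂ (a : EHVIndex) (y z : EHV α β F) : B (basis α β F a) (B y z) =
      B (B (basis α β F a) y) z + B y (B (basis α β F a) z) := by
    have : B (basis α β F a) ∘ₗ B.flip z =
        B.flip z ∘ₗ B (basis α β F a) + B.flip (B (basis α β F a) z) :=
      (basis α β F).ext fun b => h₁ a b z
    exact LinearMap.congr_fun this y
  have : B.flip (B y z) = B.flip z ∘ₗ B.flip y + B y ∘ₗ B.flip z :=
    (basis α β F).ext fun a => h₂ a y z
  exact LinearMap.congr_fun this x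

noncomputable instance : LieRing (EHV α β F) where
  add_lie x y z := by
    change bracketMap α β F _ _ = bracketMap α β F _ _ + bracketMap α β F _ _
    simp
  lie_add x y z := map_add (bracketMap α β F x) y z
  lie_self := bracketMap_self α β F
  leibniz_lie := bracketMap_leibniz α β F

noncomputable instance : LieAlgebra ℂ (EHV α β F) where
  lie_smul t x y := map_smul (bracketMap α β F x) t y

end

/-- The labels of `G_{-d₁+i}`, `J_{-d₂+i}`, `L_i` (`i ≥ 0`) and `C₁, C₂, C₃`. -/
def parabolicIndex (d₁ d₂ : ℕ) : Set EHVIndex :=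
  {a | match a with
    | .L m => 0 ≤ m
    | .J m => -(d₂ : ℤ) ≤ m
    | .G m => -(d₁ : ℤ) ≤ m
    | _ => True}

/-- For `F = 0`, the Lie subalgebra spanned by `G_{-d₁+i}`, `J_{-d₂+i}`, `L_i` (`i ≥ 0`) and
`C₁, C₂, C₃`. -/
noncomputable def parabolic (α β : ℂ) (d₁ d₂ : ℕ) : LieSubalgebra ℂ (EHV α β 0) where
  toSubmodule := Submodule.span ℂ (basis α β 0 '' parabolicIndex d₁ d₂)
  lie_mem' := by
    intro x y hx hy
    simp only [AddSubsemigroup.mem_carrier, AddSubmonoid.mem_toSubsemigroup,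
      Submodule.mem_toAddSubmonoid] at hx hy ⊢
    refine Submodule.span_induction₂ (p := fun x y _ _ =>
      ⁅x, y⁆ ∈ Submodule.span ℂ (basis α β 0 '' parabolicIndex d₁ d₂)) ?_ ?_ ?_ ?_ ?_ ?_ ?_ hx hy
    · rintro _ _ ⟨a, ha, rfl⟩ ⟨b, hb, rfl⟩
      rw [lie_basis]
      have key : ∀ c ∈ parabolicIndex d₁ d₂, ∀ t : ℂ, t • basis α β 0 c ∈
          Submodule.span ℂ (basis α β 0 '' parabolicIndex d₁ d₂) := fun c hc t =>
        Submodule.smul_mem _ t (Submodule.subset_span ⟨c, hc, rfl⟩)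
      rcases a with m | m | m | _ | _ | _ <;> rcases b with n | n | n | _ | _ | _ <;>
        simp only [basisBracket, neg_zero, zero_smul, Submodule.zero_mem]
      all_goals simp only [parabolicIndex, Set.mem_ofPred_eq] at ha hb
      all_goals first
        | exact key _ (by simp only [parabolicIndex, Set.mem_ofPred_eq]; try omega) _
        | exact Submodule.add_mem _
            (key _ (by simp only [parabolicIndex, Set.mem_ofPred_eq]; try omega) _)
            (key _ (by simp only [parabolicIndex, Set.mem_ofPred_eq]) _)
        | exact Submodule.sub_mem _
            (key _ (by simp only [parabolicIndex, Set.mem_ofPred_eq]; try omega) _)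
            (key _ (by simp only [parabolicIndex, Set.mem_ofPred_eq]) _)
    · intro y _
      simp
    · intro x _
      simp
    · intro x y z _ _ _ h₁ h₂
      rw [add_lie]
      exact Submodule.add_mem _ h₁ h₂
    · intro x y z _ _ _ h₁ h₂
      rw [lie_add]
      exact Submodule.add_mem _ h₁ h₂
    · intro r x y _ _ h
      rw [smul_lie]
      exact Submodule.smul_mem _ r h
    · intro r x y _ _ h
      rw [lie_smul]
      exact Submodule.smul_mem _ r h

variable {α β : ℂ} {d₁ d₂ : ℕ}

theorem L_mem_parabolic {m : ℤ} (h : 0 ≤ m) : L α β 0 m ∈ parabolic α β d₁ d₂ :=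
  Submodule.subset_span ⟨.L m, h, rfl⟩

theorem J_mem_parabolic {m : ℤ} (h : -(d₂ : ℤ) ≤ m) : J α β 0 m ∈ parabolic α β d₁ d₂ :=
  Submodule.subset_span ⟨.J m, h, rfl⟩

theorem G_mem_parabolic {m : ℤ} (h : -(d₁ : ℤ) ≤ m) : G α β 0 m ∈ parabolic α β d₁ d₂ :=
  Submodule.subset_span ⟨.G m, h, rfl⟩

theorem C₃_mem_parabolic : C₃ α β 0 ∈ parabolic α β d₁ d₂ :=
  Submodule.subset_span ⟨.C₃, trivial, rfl⟩

end EHV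

/-! The induced module consists of combinations of words in the L_n (n < 0) applied to words in the
J_n (n < -d₂) applied to words in the G_n (n < -d₁) applied to V. A nonzero submodule W is brought
down to V one layer at a time, by operators acting like partial derivatives: G_{k+1+p} removes the
letter L_{-1-p}, J_{d₂+1+p} removes J_{-d₂-1-p}, and L_{k+d₁+1+p} removes G_{-d₁-1-p}. The brackets
are a nonzero multiple of G_k (by the condition on α, β) in the first and third case, and of C₃ in
the second. Both G_k and C₃ act injectively on the layer below. For a letter of smaller index i < p
the bracket is a multiple of some G_n with n > k, which annihilates the layer below, or is zero for
the J's. So if p is the largest index that occurs, the operator differentiates with respect to the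
p-th letter, exactly for the G's and J's and up to shorter words for the L's; in characteristic zero
this derivative is formally nonzero. The descent is carried by `exists_mem_of_commuting_lowering`
and `exists_mem_of_graded_lowering`, and assembled in `EHV.exists_mem_of_ne_bot`. Injectivity of
G_k, given only on V, passes to the larger layers by the same descent applied to its kernel. Once W
meets V, simplicity of V gives V ⊆ W, and V generates.

The descent manipulates formal polynomials whose values lie in W, so linear independence of ordered
monomials is never needed. The only input of Poincaré-Birkhoff-Witt type is that V embeds into the
induced module (`LieModule.Ind.of_injective`); this follows by constructing a 𝔤-action on U(𝔫) ⊗ V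
for a complementary subalgebra 𝔫. -/

/-! ### Generation of the enveloping algebra. -/

section UniversalEnveloping

attribute [local instance 100] LieRing.ofAssociativeRing

variable {R L : Type*} [CommRing R] [LieRing L] [LieAlgebra R L]

theorem UniversalEnvelopingAlgebra.adjoin_range_ι :
    Algebra.adjoin R (Set.range (UniversalEnvelopingAlgebra.ι R (L := L))) = ⊤ := by
  have hs : Function.Surjective (UniversalEnvelopingAlgebra.mkAlgHom R L) :=
    RingCon.mk'_surjective _
  have h := congrArg (Subalgebra.map (UniversalEnvelopingAlgebra.mkAlgHom R L))
    (TensorAlgebra.adjoin_range_ι (R := R) (M := L))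
  rw [AlgHom.map_adjoin, Algebra.map_top, (AlgHom.range_eq_top _).mpr hs, ← Set.range_comp] at h
  exact h

/-- A subspace of `U(L)` which contains `1` and is stable under left multiplication by `L` is
everything. -/
theorem UniversalEnvelopingAlgebra.mem_of_ι_mul_mem
    (S : Submodule R (UniversalEnvelopingAlgebra R L)) (h1 : 1 ∈ S)
    (hS : ∀ x : L, ∀ u ∈ S, UniversalEnvelopingAlgebra.ι R x * u ∈ S)
    (u : UniversalEnvelopingAlgebra R L) : u ∈ S := by
  have hu : u ∈ Algebra.adjoin R (Set.range (UniversalEnvelopingAlgebra.ι R (L := L))) := by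
    rw [UniversalEnvelopingAlgebra.adjoin_range_ι]; trivial
  -- Stability of S under left multiplication by u, unlike membership of u in S, is inherited by
  -- products.
  have key : ∀ s ∈ S, u * s ∈ S := by
    induction hu using Algebra.adjoin_induction with
    | mem x hx => obtain ⟨y, rfl⟩ := hx; exact hS y
    | algebraMap r =>
      intro s hs
      rw [← Algebra.smul_def]
      exact S.smul_mem r hs
    | add x y _ _ hx hy =>
      intro s hs
      rw [add_mul]
      exact S.add_mem (hx s hs) (hy s hs)
    | mul x y _ _ hx hy =>
      intro s hs
      rw [mul_assoc]
      exact hx _ (hy s hs)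
  simpa using key 1 h1

end UniversalEnveloping

/-! ### The action of 𝔤 on U(𝔫) ⊗ V for complementary subalgebras 𝔫 and 𝔥. -/

section Complement

attribute [local instance 100] LieRing.ofAssociativeRing

variable {R 𝔤 : Type*} [CommRing R] [LieRing 𝔤] [LieAlgebra R 𝔤] (𝔥 𝔫 : LieSubalgebra R 𝔤)
  (V : Type*) [AddCommGroup V] [Module R V] [LieRingModule 𝔥 V] [LieModule R 𝔥 V]

namespace LieModule.Ind

/-- The action of `𝔫` on linear maps from `𝔤` to a free `𝔫`-module. -/
noncomputable def homAction :
    𝔫 →ₗ⁅R⁆ Module.End R (𝔤 →ₗ[R] UniversalEnvelopingAlgebra R 𝔫 ⊗[R] V) where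
  toFun x :=
    { toFun := fun F => Algebra.lsmul R R _ (UniversalEnvelopingAlgebra.ι R x) ∘ₗ F -
        F ∘ₗ LieAlgebra.ad R 𝔤 (x : 𝔤)
      map_add' := fun F F' => by
        ext z
        simp only [LinearMap.sub_apply, LinearMap.comp_apply, LinearMap.add_apply, map_add]
        abel
      map_smul' := fun r F => by
        ext z
        simp only [LinearMap.sub_apply, LinearMap.comp_apply, LinearMap.smul_apply, map_smul,
          RingHom.id_apply, smul_sub] }
  map_add' x y := by
    ext F z
    simp
    abel
  map_smul' r x := by
    ext F z
    simp [smul_sub]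
  map_lie' {x y} := by
    ext F z
    simp [LieRing.of_associative_ring_bracket, smul_sub]
    abel

theorem homAction_apply (x : 𝔫) (F : 𝔤 →ₗ[R] UniversalEnvelopingAlgebra R 𝔫 ⊗[R] V) (z : 𝔤) :
    homAction 𝔫 V x F z = UniversalEnvelopingAlgebra.ι R x • F z - F ⁅(x : 𝔤), z⁆ := rfl

variable {𝔥 𝔫} (p : 𝔤 →ₗ[R] 𝔫) (q : 𝔤 →ₗ[R] 𝔥)

/-- The map `𝔤 → U(𝔫) ⊗ V` sending `z` to `p z ⊗ v + 1 ⊗ (q z) v`. -/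
noncomputable def seed : V →ₗ[R] 𝔤 →ₗ[R] UniversalEnvelopingAlgebra R 𝔫 ⊗[R] V :=
  LinearMap.mk₂ R (fun v z => UniversalEnvelopingAlgebra.ι R (p z) ⊗ₜ[R] v + 1 ⊗ₜ[R] ⁅q z, v⁆)
    (by intros; simp only [lie_add, TensorProduct.tmul_add]; abel)
    (by intros; simp only [lie_smul, TensorProduct.tmul_smul, smul_add])
    (by
      intros
      simp only [map_add, add_lie, TensorProduct.tmul_add, TensorProduct.add_tmul]
      abel)
    (by
      intros
      simp only [map_smul, smul_lie, TensorProduct.tmul_smul, smul_add, TensorProduct.smul_tmul'])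

theorem seed_apply (v : V) (z : 𝔤) : seed V p q v z =
    UniversalEnvelopingAlgebra.ι R (p z) ⊗ₜ[R] v + 1 ⊗ₜ[R] ⁅q z, v⁆ := rfl

/-- The candidate for the action of `𝔤` on `U(𝔫) ⊗ V`, with the arguments swapped. -/
noncomputable def freeActionFlip :
    UniversalEnvelopingAlgebra R 𝔫 ⊗[R] V →ₗ[R] 𝔤 →ₗ[R] UniversalEnvelopingAlgebra R 𝔫 ⊗[R] V :=
  TensorProduct.lift ((seed V p q).lcomp R _ ∘ₗ
    (UniversalEnvelopingAlgebra.lift R (homAction 𝔫 V)).toLinearMap)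

/-- The candidate for the action of `𝔤` on `U(𝔫) ⊗ V`. -/
noncomputable def freeAction : 𝔤 →ₗ[R] Module.End R (UniversalEnvelopingAlgebra R 𝔫 ⊗[R] V) :=
  (freeActionFlip V p q).flip

theorem freeAction_one_tmul (z : 𝔤) (v : V) : freeAction V p q z (1 ⊗ₜ v) =
    UniversalEnvelopingAlgebra.ι R (p z) ⊗ₜ[R] v + 1 ⊗ₜ[R] ⁅q z, v⁆ := by
  simp [freeAction, freeActionFlip, seed_apply]

/-- The recursion z(xw) = x(zw) - [x, z]w forced on any 𝔤-action. Read as a rule for the function z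
↦ zw it is exactly `homAction`; since that is a representation of 𝔫, the recursion extends
consistently to U(𝔫). -/
theorem freeAction_ι_smul (z : 𝔤) (x : 𝔫) (w : UniversalEnvelopingAlgebra R 𝔫 ⊗[R] V) :
    freeAction V p q z (UniversalEnvelopingAlgebra.ι R x • w) =
      UniversalEnvelopingAlgebra.ι R x • freeAction V p q z w -
        freeAction V p q ⁅(x : 𝔤), z⁆ w := by
  induction w with
  | zero => simp
  | add a b ha hb =>
    rw [smul_add, map_add, ha, hb, map_add, map_add, smul_add]
    abel
  | tmul u v =>
    rw [TensorProduct.smul_tmul', smul_eq_mul]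
    change freeActionFlip V p q _ z = _ • freeActionFlip V p q _ z - freeActionFlip V p q _ _
    simp only [freeActionFlip, TensorProduct.lift.tmul, LinearMap.comp_apply,
      AlgHom.toLinearMap_apply, map_mul, UniversalEnvelopingAlgebra.lift_ι_apply,
      LinearMap.lcomp_apply, Module.End.mul_apply, homAction_apply]

/-- To prove a linear property of `U(𝔫) ⊗ V`, it suffices to check it on `1 ⊗ V` and to propagate
it along the action of `𝔫`. -/
theorem mem_of_ι_smul_mem (S : Submodule R (UniversalEnvelopingAlgebra R 𝔫 ⊗[R] V))
    (h1 : ∀ v : V, 1 ⊗ₜ v ∈ S)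
    (hS : ∀ x : 𝔫, ∀ w ∈ S, UniversalEnvelopingAlgebra.ι R x • w ∈ S)
    (w : UniversalEnvelopingAlgebra R 𝔫 ⊗[R] V) : w ∈ S := by
  induction w with
  | zero => exact S.zero_mem
  | add a b ha hb => exact S.add_mem ha hb
  | tmul u v =>
    refine UniversalEnvelopingAlgebra.mem_of_ι_mul_mem
      (S.comap ((TensorProduct.mk R (UniversalEnvelopingAlgebra R 𝔫) V).flip v)) (h1 v) ?_ u
    intro x u hu
    have := hS x _ hu
    simpa [TensorProduct.smul_tmul'] using this

/-- Induction on words in 𝔫: the recursion turns x(yw) into yxw - [y, x]w, which is xyw in U(𝔫). -/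
theorem freeAction_coe (hp : ∀ x : 𝔫, p x = x) (hq : ∀ x : 𝔫, q x = 0) (x : 𝔫)
    (w : UniversalEnvelopingAlgebra R 𝔫 ⊗[R] V) :
    freeAction V p q x w = UniversalEnvelopingAlgebra.ι R x • w := by
  let S : Submodule R (UniversalEnvelopingAlgebra R 𝔫 ⊗[R] V) :=
    ⨅ x : 𝔫, LinearMap.eqLocus (freeAction V p q x)
      (Algebra.lsmul R R _ (UniversalEnvelopingAlgebra.ι R x))
  have hS : ∀ w, w ∈ S ↔ ∀ x : 𝔫,
      freeAction V p q x w = UniversalEnvelopingAlgebra.ι R x • w := by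
    intro w
    simp only [S, Submodule.mem_iInf, LinearMap.mem_eqLocus, Algebra.lsmul_coe]
  refine (hS w).1 (mem_of_ι_smul_mem V S (fun v => (hS _).2 fun x => ?_)
    (fun y w hw => (hS _).2 fun x => ?_) w) x
  · rw [freeAction_one_tmul, hp, hq, zero_lie, TensorProduct.tmul_zero, add_zero,
      TensorProduct.smul_tmul', smul_eq_mul, mul_one]
  · rw [hS] at hw
    rw [freeAction_ι_smul, ← LieSubalgebra.coe_bracket, hw, hw, LieHom.map_lie,
      LieRing.of_associative_ring_bracket, sub_smul, mul_smul, mul_smul, sub_sub_cancel]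

/-- The defect of `freeAction` from being a representation vanishes. -/
theorem freeAction_lie (hp : ∀ x : 𝔫, p x = x) (hq : ∀ x : 𝔫, q x = 0)
    (hp' : ∀ y : 𝔥, p y = 0) (hq' : ∀ y : 𝔥, q y = y)
    (hpq : ∀ z : 𝔤, (p z : 𝔤) + q z = z) (z z' : 𝔤)
    (w : UniversalEnvelopingAlgebra R 𝔫 ⊗[R] V) :
    freeAction V p q ⁅z, z'⁆ w =
      freeAction V p q z (freeAction V p q z' w) - freeAction V p q z' (freeAction V p q z w) := by
  let a := freeAction V p q
  let D : 𝔤 → 𝔤 → Module.End R (UniversalEnvelopingAlgebra R 𝔫 ⊗[R] V) :=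
    fun z z' => a z * a z' - a z' * a z - a ⁅z, z'⁆
  have hD : ∀ z z' w, D z z' w = a z (a z' w) - a z' (a z w) - a ⁅z, z'⁆ w := fun _ _ _ => rfl
  have hx : ∀ (z : 𝔤) (x : 𝔫) w, a z (a x w) = a x (a z w) - a ⁅(x : 𝔤), z⁆ w := by
    intro z x w
    simp only [a, freeAction_coe V p q hp hq, freeAction_ι_smul]
  have hDx : ∀ (x : 𝔫) (z : 𝔤) w, D x z w = 0 := by
    intro x z w
    rw [hD, hx]; abel
  have hDx' : ∀ (x : 𝔫) (z : 𝔤) w, D z x w = 0 := by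
    intro x z w
    rw [hD, hx, ← lie_skew z (x : 𝔤), map_neg, LinearMap.neg_apply]; abel
  have hadd : ∀ z₁ z₂ z w, D (z₁ + z₂) z w = D z₁ z w + D z₂ z w := by
    intro z₁ z₂ z w
    simp only [hD, map_add, LinearMap.add_apply, add_lie]; abel
  have hadd' : ∀ z₁ z₂ z w, D z (z₁ + z₂) w = D z z₁ w + D z z₂ w := by
    intro z₁ z₂ z w
    simp only [hD, map_add, LinearMap.add_apply, lie_add]; abel
  -- The defect vanishes as soon as one argument lies in 𝔫, so only the 𝔥-components matter.
  have hred : ∀ z z' w, D z z' w = D (q z) (q z') w := by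
    intro z z' w
    conv_lhs => rw [← hpq z, ← hpq z', hadd, hDx, hadd', hDx', zero_add, zero_add]
  -- By the Jacobi identity the defect is 𝔫-equivariant, so its vanishing on 𝔥 × 𝔥 spreads from 1 ⊗
  -- V, where 𝔥 acts as on V, to all of U(𝔫) ⊗ V.
  have hcomm : ∀ (x : 𝔫) z z' w, D z z' (a x w) =
      a x (D z z' w) - D ⁅(x : 𝔤), z⁆ z' w - D z ⁅(x : 𝔤), z'⁆ w := by
    intro x z z' w
    simp only [hD, hx, map_sub, leibniz_lie (x : 𝔤) z z', map_add, LinearMap.add_apply]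
    abel
  let S : Submodule R (UniversalEnvelopingAlgebra R 𝔫 ⊗[R] V) :=
    ⨅ y : 𝔥, ⨅ y' : 𝔥, LinearMap.ker (D y y')
  have hS : ∀ w, w ∈ S ↔ ∀ y y' : 𝔥, D y y' w = 0 := by
    intro w
    simp only [S, Submodule.mem_iInf, LinearMap.mem_ker]
  have key := (hS w).1 (mem_of_ι_smul_mem V S (fun v => (hS _).2 fun y y' => ?_)
    (fun x w hw => (hS _).2 fun y y' => ?_) w) (q z) (q z')
  · rw [← hred, hD] at key
    exact (sub_eq_zero.1 key).symm
  · rw [hD, ← LieSubalgebra.coe_bracket]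
    simp only [a, freeAction_one_tmul, hp', hq', map_zero, TensorProduct.zero_tmul, zero_add,
      ← TensorProduct.tmul_sub, lie_lie, sub_self]
  · rw [hS] at hw
    rw [← freeAction_coe V p q hp hq]
    change D y y' (a x w) = 0
    rw [hcomm, hw, hred _ (y' : 𝔤), hred (y : 𝔤), hw, hw, map_zero, sub_zero, sub_zero]

end LieModule.Ind
end Complement

/-! ### The embedding of V into the induced module. -/

section InducedEmbedding

attribute [local instance 100] LieRing.ofAssociativeRing

variable {R 𝔤 : Type*} [CommRing R] [LieRing 𝔤] [LieAlgebra R 𝔤] (𝔥 : LieSubalgebra R 𝔤)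
  (V : Type*) [AddCommGroup V] [Module R V] [LieRingModule 𝔥 V] [LieModule R 𝔥 V]

namespace LieModule.Ind

/-- The quotient map onto the induced module. -/
noncomputable def mk : UniversalEnvelopingAlgebra R 𝔤 ⊗[R] V →ₗ[UniversalEnvelopingAlgebra R 𝔤]
    LieModule.Ind 𝔥 V :=
  (LieModule.balancedRelations 𝔥 V).mkQ

theorem mk_eq_zero {t : UniversalEnvelopingAlgebra R 𝔤 ⊗[R] V} :
    mk 𝔥 V t = 0 ↔ t ∈ LieModule.balancedRelations 𝔥 V :=
  Submodule.Quotient.mk_eq_zero _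

theorem mk_surjective : Function.Surjective (mk 𝔥 V) := Submodule.mkQ_surjective _

/-- The canonical map from `V` to the module induced by `V`. -/
noncomputable def of : V →ₗ[R] LieModule.Ind 𝔥 V :=
  (mk 𝔥 V).restrictScalars R ∘ₗ TensorProduct.mk R (UniversalEnvelopingAlgebra R 𝔤) V 1

theorem of_apply (v : V) : of 𝔥 V v = mk 𝔥 V (1 ⊗ₜ v) := rfl

theorem lie_eq_ι_smul (x : 𝔤) (w : LieModule.Ind 𝔥 V) :
    ⁅x, w⁆ = UniversalEnvelopingAlgebra.ι R x • w := rfl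

theorem lie_of (y : 𝔥) (v : V) : ⁅(y : 𝔤), of 𝔥 V v⁆ = of 𝔥 V ⁅y, v⁆ := by
  rw [lie_eq_ι_smul, of_apply, of_apply, ← map_smul, ← sub_eq_zero, ← map_sub, mk_eq_zero]
  refine Submodule.subset_span ⟨1, UniversalEnvelopingAlgebra.ι R y, v, ?_⟩
  rw [LieModule.envelopingAction, LieSubalgebra.envelopingMap,
    UniversalEnvelopingAlgebra.lift_ι_apply, UniversalEnvelopingAlgebra.lift_ι_apply,
    TensorProduct.smul_tmul', smul_eq_mul, mul_one, one_mul]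
  rfl

/-- A subspace of the induced module which contains `V` and is stable under `𝔤` is everything. -/
theorem eq_top_of_lie_mem (S : Submodule R (LieModule.Ind 𝔥 V)) (h : ∀ v, of 𝔥 V v ∈ S)
    (hS : ∀ x : 𝔤, ∀ w ∈ S, ⁅x, w⁆ ∈ S) : S = ⊤ := by
  rw [eq_top_iff]
  rintro w -
  obtain ⟨t, rfl⟩ := mk_surjective 𝔥 V w
  induction t with
  | zero => rw [map_zero]; exact S.zero_mem
  | add a b ha hb => rw [map_add]; exact S.add_mem ha hb
  | tmul u v =>
    refine UniversalEnvelopingAlgebra.mem_of_ι_mul_mem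
      (S.comap ((mk 𝔥 V).restrictScalars R ∘ₗ
        (TensorProduct.mk R (UniversalEnvelopingAlgebra R 𝔤) V).flip v)) (h v) ?_ u
    intro x u hu
    have := hS x _ hu
    rw [lie_eq_ι_smul] at this
    change mk 𝔥 V ((UniversalEnvelopingAlgebra.ι R x * u) ⊗ₜ v) ∈ S
    rw [← smul_eq_mul, ← TensorProduct.smul_tmul', map_smul]
    exact this

variable {𝔥} {𝔫 : LieSubalgebra R 𝔤}

/-- If `𝔥` has a complement in `𝔤` which is a subalgebra, then `V` embeds into the module
induced from `𝔥` to `𝔤`. -/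
theorem of_injective_of_projections (p : 𝔤 →ₗ[R] 𝔫) (q : 𝔤 →ₗ[R] 𝔥)
    (hp : ∀ x : 𝔫, p x = x) (hq : ∀ x : 𝔫, q x = 0)
    (hp' : ∀ y : 𝔥, p y = 0) (hq' : ∀ y : 𝔥, q y = y)
    (hpq : ∀ z : 𝔤, (p z : 𝔤) + q z = z) : Function.Injective (of 𝔥 V) := by
  let a : 𝔤 →ₗ⁅R⁆ Module.End R (UniversalEnvelopingAlgebra R 𝔫 ⊗[R] V) :=
    { freeAction V p q with
      map_lie' := fun {z z'} => by
        refine LinearMap.ext fun w => ?_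
        exact freeAction_lie V p q hp hq hp' hq' hpq z z' w }
  let A := UniversalEnvelopingAlgebra.lift R a
  -- u ⊗ v ↦ u·(1 ⊗ v). It kills the balanced relations and sends 1 ⊗ v to 1 ⊗ v, so it detects V in
  -- the quotient.
  let B : UniversalEnvelopingAlgebra R 𝔤 ⊗[R] V →ₗ[R] UniversalEnvelopingAlgebra R 𝔫 ⊗[R] V :=
    TensorProduct.lift ((TensorProduct.mk R (UniversalEnvelopingAlgebra R 𝔫) V 1).lcomp R _ ∘ₗ
      A.toLinearMap)
  have hB : ∀ u v, B (u ⊗ₜ v) = A u (1 ⊗ₜ v) := fun _ _ => rfl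
  have hBs : ∀ u t, B (u • t) = A u (B t) := by
    intro u t
    induction t with
    | zero => simp
    | add x y hx hy => rw [smul_add, map_add, map_add, map_add, hx, hy]
    | tmul u' v =>
      rw [TensorProduct.smul_tmul', smul_eq_mul, hB, hB, map_mul]
      rfl
  have hy : ∀ y v, A (𝔥.envelopingMap y) (1 ⊗ₜ v) =
      1 ⊗ₜ LieModule.envelopingAction R 𝔥 V y v := by
    intro y
    let T : Submodule R (UniversalEnvelopingAlgebra R 𝔥) := ⨅ v : V, LinearMap.eqLocus
      ((LinearMap.applyₗ (1 ⊗ₜ v)) ∘ₗ A.toLinearMap ∘ₗ 𝔥.envelopingMap.toLinearMap)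
      (TensorProduct.mk R (UniversalEnvelopingAlgebra R 𝔫) V 1 ∘ₗ LinearMap.applyₗ v ∘ₗ
        (LieModule.envelopingAction R 𝔥 V).toLinearMap)
    have hT : ∀ y, y ∈ T ↔ ∀ v, A (𝔥.envelopingMap y) (1 ⊗ₜ v) =
        1 ⊗ₜ LieModule.envelopingAction R 𝔥 V y v := by
      intro y
      simp [T, Submodule.mem_iInf, LinearMap.mem_eqLocus]
    refine (hT y).1 (UniversalEnvelopingAlgebra.mem_of_ι_mul_mem T ((hT _).2 fun v => ?_)
      (fun x u hu => (hT _).2 fun v => ?_) y)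
    · simp
    · have hx : 𝔥.envelopingMap (UniversalEnvelopingAlgebra.ι R x) =
          UniversalEnvelopingAlgebra.ι R (x : 𝔤) := by
        rw [LieSubalgebra.envelopingMap, UniversalEnvelopingAlgebra.lift_ι_apply]
        rfl
      have hx' : LieModule.envelopingAction R 𝔥 V (UniversalEnvelopingAlgebra.ι R x) =
          LieModule.toEnd R 𝔥 V x := by
        rw [LieModule.envelopingAction, UniversalEnvelopingAlgebra.lift_ι_apply]
      rw [map_mul, map_mul, map_mul, Module.End.mul_apply, (hT u).1 hu, hx, hx',
        Module.End.mul_apply, UniversalEnvelopingAlgebra.lift_ι_apply]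
      change freeAction V p q x _ = _
      rw [freeAction_one_tmul, hp', hq', map_zero, TensorProduct.zero_tmul, zero_add]
      rfl
  have hker : ∀ t ∈ LieModule.balancedRelations 𝔥 V, B t = 0 := by
    intro t ht
    induction ht using Submodule.span_induction with
    | mem t ht =>
      obtain ⟨u, y, v, rfl⟩ := ht
      rw [map_sub, hB, hB, map_mul, Module.End.mul_apply, hy, sub_self]
    | zero => exact map_zero _
    | add x y _ _ hx hy => rw [map_add, hx, hy, add_zero]
    | smul u x _ hx => rw [hBs, hx, map_zero]
  rw [← LinearMap.ker_eq_bot, LinearMap.ker_eq_bot']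
  intro v hv
  rw [of_apply, mk_eq_zero] at hv
  have h1 := hker _ hv
  rw [hB, map_one, Module.End.one_apply] at h1
  -- The augmentation of U(𝔫) recovers v from 1 ⊗ v.
  let ε : UniversalEnvelopingAlgebra R 𝔫 →ₐ[R] R := UniversalEnvelopingAlgebra.lift R 0
  have h2 := congrArg ((TensorProduct.lid R V).toLinearMap ∘ₗ ε.toLinearMap.rTensor V) h1
  simpa using h2

/-- If `𝔥` has a complement in `𝔤` which is a subalgebra, then `V` embeds into the module
induced from `𝔥` to `𝔤`. -/
theorem of_injective (hc : IsCompl 𝔫.toSubmodule 𝔥.toSubmodule) :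
    Function.Injective (of 𝔥 V) := by
  refine of_injective_of_projections V (𝔫 := 𝔫)
    (Submodule.projectionOnto 𝔫.toSubmodule 𝔥.toSubmodule hc)
    (Submodule.projectionOnto 𝔥.toSubmodule 𝔫.toSubmodule hc.symm) ?_ ?_ ?_ ?_ ?_
  · intro x; exact Submodule.projectionOnto_apply_left hc x
  · intro x; exact Submodule.projectionOnto_apply_right hc.symm x
  · intro x; exact Submodule.projectionOnto_apply_right hc x
  · intro x; exact Submodule.projectionOnto_apply_left hc.symm x
  · intro z; exact Submodule.projection_add_projection_eq_self hc z

end LieModule.Ind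

end InducedEmbedding

/-! ### Words in a family of operators, and descent by formal derivatives. -/

section Words

variable {K M : Type*} [Field K] [AddCommGroup M] [Module K M]

/-- The span of the vectors `X_{i₁} ⋯ X_{iᵣ} s` with `r < n` and `s ∈ S`. -/
def wordSpan (X : ℕ → Module.End K M) (S : Submodule K M) (n : ℕ) : Submodule K M :=
  Submodule.span K {w | ∃ l : List ℕ, l.length < n ∧ ∃ s ∈ S, w = (l.map X).prod s}

/-- The smallest subspace which contains `S` and is stable under all the `X_i`. -/
def wordClosure (X : ℕ → Module.End K M) (S : Submodule K M) : Submodule K M :=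
  Submodule.span K {w | ∃ l : List ℕ, ∃ s ∈ S, w = (l.map X).prod s}

variable {X : ℕ → Module.End K M} {S : Submodule K M}

theorem prod_mem_wordSpan {n : ℕ} {l : List ℕ} (hl : l.length < n) {s : M} (hs : s ∈ S) :
    (l.map X).prod s ∈ wordSpan X S n :=
  Submodule.subset_span ⟨l, hl, s, hs, rfl⟩

theorem prod_mem_wordClosure (l : List ℕ) {s : M} (hs : s ∈ S) :
    (l.map X).prod s ∈ wordClosure X S :=
  Submodule.subset_span ⟨l, s, hs, rfl⟩

theorem subset_wordClosure {s : M} (hs : s ∈ S) : s ∈ wordClosure X S :=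
  prod_mem_wordClosure [] hs

theorem wordSpan_zero : wordSpan X S 0 = ⊥ := by
  simp [wordSpan]

theorem wordSpan_mono {m n : ℕ} (h : m ≤ n) : wordSpan X S m ≤ wordSpan X S n :=
  Submodule.span_mono fun _ ⟨l, hl, s, hs, hw⟩ => ⟨l, hl.trans_le h, s, hs, hw⟩

theorem wordSpan_le {n : ℕ} {N : Submodule K M}
    (h : ∀ l : List ℕ, l.length < n → ∀ s ∈ S, (l.map X).prod s ∈ N) : wordSpan X S n ≤ N := by
  refine Submodule.span_le.2 ?_
  rintro _ ⟨l, hl, s, hs, rfl⟩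
  exact h l hl s hs

theorem wordClosure_le {N : Submodule K M}
    (h : ∀ l : List ℕ, ∀ s ∈ S, (l.map X).prod s ∈ N) : wordClosure X S ≤ N := by
  refine Submodule.span_le.2 ?_
  rintro _ ⟨l, s, hs, rfl⟩
  exact h l s hs

theorem apply_mem_wordSpan (i : ℕ) {n : ℕ} {w : M} (hw : w ∈ wordSpan X S n) :
    X i w ∈ wordSpan X S (n + 1) := by
  have : wordSpan X S n ≤ (wordSpan X S (n + 1)).comap (X i) := by
    refine wordSpan_le fun l hl s hs => ?_
    exact prod_mem_wordSpan (l := i :: l) (by simpa using hl) hs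
  exact this hw

theorem apply_mem_wordClosure (i : ℕ) {w : M} (hw : w ∈ wordClosure X S) :
    X i w ∈ wordClosure X S := by
  have : wordClosure X S ≤ (wordClosure X S).comap (X i) :=
    wordClosure_le fun l s hs => prod_mem_wordClosure (i :: l) hs
  exact this hw

theorem exists_mem_wordSpan {w : M} (hw : w ∈ wordClosure X S) : ∃ n, w ∈ wordSpan X S n := by
  induction hw using Submodule.span_induction with
  | mem w hw =>
    obtain ⟨l, s, hs, rfl⟩ := hw
    exact ⟨l.length + 1, prod_mem_wordSpan (Nat.lt_succ_self _) hs⟩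
  | zero => exact ⟨0, Submodule.zero_mem _⟩
  | add x y _ _ hx hy =>
    obtain ⟨m, hm⟩ := hx
    obtain ⟨n, hn⟩ := hy
    exact ⟨max m n, Submodule.add_mem _ (wordSpan_mono (le_max_left _ _) hm)
      (wordSpan_mono (le_max_right _ _) hn)⟩
  | smul r x _ hx =>
    obtain ⟨n, hn⟩ := hx
    exact ⟨n, Submodule.smul_mem _ _ hn⟩

/-- If the `X_i` commute up to shorter words, then permuting a word changes it by shorter words. -/
theorem prod_sub_prod_mem_wordSpan_of_perm
    (hX : ∀ i j n, ∀ y ∈ wordSpan X S n, X i (X j y) - X j (X i y) ∈ wordSpan X S (n + 1))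
    {l l' : List ℕ} (h : l.Perm l') {s : M} (hs : s ∈ S) :
    (l.map X).prod s - (l'.map X).prod s ∈ wordSpan X S l.length := by
  induction h with
  | nil => simp
  | cons i h ih =>
    have := apply_mem_wordSpan i ih
    simpa using this
  | swap i j l =>
    simpa using hX j i _ _ (prod_mem_wordSpan (Nat.lt_succ_self l.length) hs)
  | trans h₁ h₂ ih₁ ih₂ =>
    rw [← h₁.length_eq] at ih₂
    simpa using Submodule.add_mem _ ih₁ ih₂

variable (X S) in
/-- The evaluation of formal expressions: `m ↦ s` goes to the product over `m` of the `X_i`,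
applied to `s`. -/
noncomputable def evalWords : (Multiset ℕ →₀ S) →ₗ[K] M :=
  Finsupp.lsum K fun m => (m.toList.map X).prod ∘ₗ S.subtype

theorem evalWords_single (m : Multiset ℕ) (s : S) :
    evalWords X S (Finsupp.single m s) = (m.toList.map X).prod s := by
  simp [evalWords]

theorem evalWords_eq_sum (f : Multiset ℕ →₀ S) :
    evalWords X S f = ∑ m ∈ f.support, (m.toList.map X).prod (f m) := by
  simp [evalWords, Finsupp.sum]

/-- Bringing a word into the order chosen by `Multiset.toList` costs only shorter words, which the
induction absorbs. The formal expression need not be unique. -/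
theorem wordSpan_le_map_evalWords
    (hX : ∀ i j n, ∀ y ∈ wordSpan X S n, X i (X j y) - X j (X i y) ∈ wordSpan X S (n + 1))
    (n : ℕ) : wordSpan X S n ≤
      (Finsupp.supported S K {m : Multiset ℕ | m.card < n}).map (evalWords X S) := by
  induction n with
  | zero => simp [wordSpan_zero]
  | succ n ih =>
    refine wordSpan_le fun l hl s hs => ?_
    have hp : l.Perm (l : Multiset ℕ).toList := Multiset.coe_eq_coe.1 (by simp)
    have h₁ := ih (wordSpan_mono (Nat.lt_succ_iff.1 hl)
      (prod_sub_prod_mem_wordSpan_of_perm hX hp hs))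
    have h₂ : ((l : Multiset ℕ).toList.map X).prod s ∈
        (Finsupp.supported S K {m : Multiset ℕ | m.card < n + 1}).map (evalWords X S) :=
      ⟨Finsupp.single (l : Multiset ℕ) ⟨s, hs⟩, Finsupp.single_mem_supported K _ (by simpa using hl),
        evalWords_single _ _⟩
    have h₃ := Submodule.map_mono (f := evalWords X S) (Finsupp.supported_mono
      (R := K) (M := S) (s := {m : Multiset ℕ | m.card < n})
      (t := {m : Multiset ℕ | m.card < n + 1}) fun m hm => Nat.lt_succ_of_lt hm) h₁
    simpa using Submodule.add_mem _ h₃ h₂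

theorem evalWords_mem_wordSpan {n : ℕ} {f : Multiset ℕ →₀ S}
    (hf : ∀ m ∈ f.support, m.card < n) : evalWords X S f ∈ wordSpan X S n := by
  rw [evalWords_eq_sum]
  exact Submodule.sum_mem _ fun m hm => prod_mem_wordSpan (by simpa using hf m hm) (f m).2

/-- The formal partial derivative with respect to the `p`-th variable, followed by `e` on the
coefficients. -/
noncomputable def formalDeriv (p : ℕ) (e : S →ₗ[K] S) :
    (Multiset ℕ →₀ S) →ₗ[K] (Multiset ℕ →₀ S) :=
  Finsupp.lsum K fun m => m.count p • Finsupp.lsingle (m.erase p) ∘ₗ e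

theorem formalDeriv_single (p : ℕ) (e : S →ₗ[K] S) (m : Multiset ℕ) (s : S) :
    formalDeriv p e (Finsupp.single m s) = m.count p • Finsupp.single (m.erase p) (e s) := by
  simp [formalDeriv]

/-- Only the monomial `p ::ₘ m` can contribute to the coefficient of `m`, and it contains p once
more than `m` does. -/
theorem formalDeriv_apply (p : ℕ) (e : S →ₗ[K] S) (f : Multiset ℕ →₀ S) (m : Multiset ℕ) :
    formalDeriv p e f m = (m.count p + 1) • e (f (p ::ₘ m)) := by
  induction f using Finsupp.induction_linear with
  | zero => simp
  | add f g hf hg => simp [hf, hg]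
  | single m' s =>
    rw [formalDeriv_single]
    by_cases hp : p ∈ m'
    · obtain ⟨m'', rfl⟩ := Multiset.exists_cons_of_mem hp
      by_cases h : m'' = m
      · subst h; simp
      · rw [Finsupp.smul_apply, Multiset.erase_cons_head, Finsupp.single_eq_of_ne' h,
          Finsupp.single_eq_of_ne' (by simpa using h)]
        simp
    · rw [Multiset.count_eq_zero_of_notMem hp, Finsupp.single_eq_of_ne']
      · simp
      · rintro rfl
        exact hp (Multiset.mem_cons_self _ _)

theorem formalDeriv_ne_zero [CharZero K] {p : ℕ} {e : S →ₗ[K] S} (he : ∀ s, e s = 0 → s = 0)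
    {f : Multiset ℕ →₀ S} {m : Multiset ℕ} (hm : f m ≠ 0) (hp : p ∈ m) :
    formalDeriv p e f ≠ 0 := by
  intro h
  have h₁ := formalDeriv_apply p e f (m.erase p)
  rw [h, Multiset.cons_erase hp, Finsupp.coe_zero, Pi.zero_apply, ← Nat.cast_smul_eq_nsmul K] at h₁
  rcases smul_eq_zero.1 h₁.symm with h₂ | h₂
  · exact Nat.cast_ne_zero.2 (Nat.succ_ne_zero _) h₂
  · exact hm (he _ h₂)

theorem cons_mem_support_of_mem_support_formalDeriv {p : ℕ} {e : S →ₗ[K] S}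
    {f : Multiset ℕ →₀ S} {m : Multiset ℕ} (hm : m ∈ (formalDeriv p e f).support) :
    p ::ₘ m ∈ f.support := by
  rw [Finsupp.mem_support_iff, formalDeriv_apply] at hm
  rw [Finsupp.mem_support_iff]
  rintro h
  simp [h] at hm

theorem evalWords_formalDeriv (p : ℕ) (e : S →ₗ[K] S) (f : Multiset ℕ →₀ S) :
    evalWords X S (formalDeriv p e f) =
      ∑ m ∈ f.support, m.count p • ((m.erase p).toList.map X).prod (e (f m)) := by
  conv_lhs => rw [← Finsupp.sum_single f, Finsupp.sum, map_sum, map_sum]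
  refine Finset.sum_congr rfl fun m _ => ?_
  rw [formalDeriv_single, map_nsmul, evalWords_single]

/-- Among finitely many multisets, not all empty, there is one with a largest element. -/
theorem exists_max_index (F : Finset (Multiset ℕ)) (h : ∃ m ∈ F, m ≠ 0) :
    ∃ p, (∃ m ∈ F, p ∈ m) ∧ ∀ m ∈ F, ∀ i ∈ m, i ≤ p := by
  let A : Finset ℕ := F.biUnion Multiset.toFinset
  have hA : A.Nonempty := by
    obtain ⟨m, hm, h0⟩ := h
    obtain ⟨i, hi⟩ := Multiset.exists_mem_of_ne_zero h0
    exact ⟨i, Finset.mem_biUnion.2 ⟨m, hm, by simpa using hi⟩⟩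
  obtain ⟨p, hp, hmax⟩ := A.exists_max_image id hA
  refine ⟨p, ?_, fun m hm i hi => hmax i (Finset.mem_biUnion.2 ⟨m, hm, by simpa using hi⟩)⟩
  obtain ⟨m, hm, hpm⟩ := Finset.mem_biUnion.1 hp
  exact ⟨m, hm, by simpa using hpm⟩

/-- The end of the descent: a formal polynomial without letters is an element of S. -/
theorem exists_mem_of_evalWords_mem {f : Multiset ℕ →₀ S} (hf : f ≠ 0)
    (h0 : ∀ m ∈ f.support, m = 0) {W : Submodule K M} (hW : evalWords X S f ∈ W) :
    ∃ s ∈ S, s ≠ 0 ∧ s ∈ W := by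
  have hfs : f = Finsupp.single 0 (f 0) :=
    Finsupp.support_subset_singleton.1 fun m hm => by simpa using h0 m hm
  rw [hfs, evalWords_single] at hW
  refine ⟨f 0, (f 0).2, fun h => hf ?_, by simpa using hW⟩
  rw [hfs, (Submodule.coe_eq_zero.1 h : f 0 = 0), Finsupp.single_zero]

/-- A subspace which contains a nonzero combination of words and is stable under operators `D_p`
that act, up to shorter words, as the derivative with respect to the largest variable contains a
nonzero element of `S`. -/
theorem exists_mem_of_lowering [CharZero K]
    (hX : ∀ i j n, ∀ y ∈ wordSpan X S n, X i (X j y) - X j (X i y) ∈ wordSpan X S (n + 1))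
    (D : ℕ → Module.End K M) (e : ℕ → S →ₗ[K] S) (he : ∀ p s, e p s = 0 → s = 0)
    (hD : ∀ p n, ∀ y ∈ wordSpan X S (n + 1), D p y ∈ wordSpan X S n)
    (hDe : ∀ p (l : List ℕ) (s : S), (∀ i ∈ l, i ≤ p) → D p ((l.map X).prod s) -
      l.count p • ((l.erase p).map X).prod (e p s) ∈ wordSpan X S (l.length - 1))
    (W : Submodule K M) (hW : ∀ p, ∀ w ∈ W, D p w ∈ W) {w : M} (hw : w ∈ W) (h0 : w ≠ 0)
    (hwX : w ∈ wordClosure X S) : ∃ s ∈ S, s ≠ 0 ∧ s ∈ W := by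
  -- Only the formal leading part f has to be nonzero; its value may vanish. Each derivative lowers
  -- the degree r by one.
  have key : ∀ r (f : Multiset ℕ →₀ S), f ≠ 0 → (∀ m ∈ f.support, m.card = r) →
      ∀ y ∈ wordSpan X S r, evalWords X S f + y ∈ W → ∃ s ∈ S, s ≠ 0 ∧ s ∈ W := by
    intro r
    induction r with
    | zero =>
      intro f hf hr y hy hfy
      rw [wordSpan_zero, Submodule.mem_bot] at hy
      rw [hy, add_zero] at hfy
      exact exists_mem_of_evalWords_mem hf (fun m hm => by simpa using hr m hm) hfy
    | succ r ih =>
      intro f hf hr y hy hfy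
      -- p is maximal only among the letters of the leading part; `hD` controls what happens to y.
      obtain ⟨p, ⟨m, hm, hpm⟩, hmax⟩ := exists_max_index f.support (by
        obtain ⟨m, hm⟩ := Finsupp.support_nonempty_iff.2 hf
        refine ⟨m, hm, ?_⟩
        rintro rfl
        simpa using hr _ hm)
      refine ih (formalDeriv p (e p) f)
        (formalDeriv_ne_zero (he p) (Finsupp.mem_support_iff.1 hm) hpm) (fun m' hm' => ?_)
        (D p (evalWords X S f + y) - evalWords X S (formalDeriv p (e p) f)) ?_ ?_
      · simpa using hr _ (cons_mem_support_of_mem_support_formalDeriv hm')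
      · rw [map_add, add_sub_right_comm]
        refine Submodule.add_mem _ ?_ (hD p r y hy)
        rw [evalWords_formalDeriv, evalWords_eq_sum, map_sum, ← Finset.sum_sub_distrib]
        refine Submodule.sum_mem _ fun m hm => ?_
        have hc : m.toList.length = r + 1 := by simpa using hr m hm
        have h₁ := hDe p m.toList (f m) (by simpa using hmax m hm)
        rw [hc, Nat.add_sub_cancel] at h₁
        have hcount : m.toList.count p = m.count p := by
          conv_rhs => rw [← Multiset.coe_toList m, Multiset.coe_count]
        by_cases hp : p ∈ m
        · have hperm : (m.toList.erase p).Perm (m.erase p).toList := by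
            rw [← Multiset.coe_eq_coe, ← Multiset.coe_erase, Multiset.coe_toList,
              Multiset.coe_toList]
          have h₂ := prod_sub_prod_mem_wordSpan_of_perm hX hperm (e p (f m)).2
          rw [List.length_erase_of_mem (by simpa using hp), hc, Nat.add_sub_cancel] at h₂
          have h₃ := Submodule.add_mem _ h₁ (Submodule.smul_of_tower_mem _ (m.count p) h₂)
          rwa [hcount, smul_sub, sub_add_sub_cancel] at h₃
        · rw [hcount, Multiset.count_eq_zero_of_notMem hp, zero_smul] at h₁
          rwa [Multiset.count_eq_zero_of_notMem hp, zero_smul]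
      · rw [add_sub_cancel]
        exact hW p _ hfy
  obtain ⟨n, hn⟩ := exists_mem_wordSpan hwX
  induction n with
  | zero =>
    rw [wordSpan_zero, Submodule.mem_bot] at hn
    exact absurd hn h0
  | succ n ih =>
    -- At the least n + 1 with w in the span, the degree n part of a formal expression for w is
    -- nonzero, as otherwise w would be a combination of shorter words.
    by_cases hn' : w ∈ wordSpan X S n
    · exact ih hn'
    · obtain ⟨g, hg, rfl⟩ := wordSpan_le_map_evalWords hX _ hn
      classical
      have hsplit := Finsupp.filter_add_filter_not g (fun m => m.card = n)
      have hlow : evalWords X S (g.filter fun m => ¬ m.card = n) ∈ wordSpan X S n := by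
        refine evalWords_mem_wordSpan fun m hm => ?_
        rw [Finsupp.support_filter, Finset.mem_filter] at hm
        have : m.card < n + 1 := (Finsupp.mem_supported K g).1 hg hm.1
        omega
      refine key n (g.filter fun m => m.card = n) (fun h => hn' ?_) (fun m hm => ?_) _ hlow ?_
      · rw [← hsplit, h, zero_add]
        exact hlow
      · rw [Finsupp.support_filter, Finset.mem_filter] at hm
        exact hm.2
      · rw [← map_add, hsplit]
        exact hw

/-- A subspace which contains a nonzero combination of words in commuting operators and is stable
under operators `D_p` that act as the derivative with respect to the largest variable contains a
nonzero element of `S`. -/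
theorem exists_mem_of_exact_lowering [CharZero K] (hX : ∀ i j y, X i (X j y) = X j (X i y))
    (D : ℕ → Module.End K M) (e : ℕ → S →ₗ[K] S) (he : ∀ p s, e p s = 0 → s = 0)
    (hDe : ∀ p (l : List ℕ) (s : S), (∀ i ∈ l, i ≤ p) → D p ((l.map X).prod s) =
      l.count p • ((l.erase p).map X).prod (e p s))
    (W : Submodule K M) (hW : ∀ p, ∀ w ∈ W, D p w ∈ W) {w : M} (hw : w ∈ W) (h0 : w ≠ 0)
    (hwX : w ∈ wordClosure X S) : ∃ s ∈ S, s ≠ 0 ∧ s ∈ W := by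
  have hperm : ∀ {l l' : List ℕ}, l.Perm l' → ∀ s, (l.map X).prod s = (l'.map X).prod s := by
    intro l l' h s
    induction h with
    | nil => rfl
    | cons i _ ih => simp [ih]
    | swap i j l => simp [hX i j]
    | trans _ _ ih₁ ih₂ => exact ih₁.trans ih₂
  have key : ∀ n (f : Multiset ℕ →₀ S), f ≠ 0 → (∀ m ∈ f.support, m.card ≤ n) →
      evalWords X S f ∈ W → ∃ s ∈ S, s ≠ 0 ∧ s ∈ W := by
    intro n
    induction n with
    | zero =>
      intro f hf hn hfW
      exact exists_mem_of_evalWords_mem hf (fun m hm => by simpa using hn m hm) hfW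
    | succ n ih =>
      intro f hf hn hfW
      by_cases hne : ∃ m ∈ f.support, m ≠ 0
      · obtain ⟨p, ⟨m, hm, hpm⟩, hmax⟩ := exists_max_index f.support hne
        refine ih (formalDeriv p (e p) f)
          (formalDeriv_ne_zero (he p) (Finsupp.mem_support_iff.1 hm) hpm) (fun m' hm' => ?_) ?_
        · simpa using hn _ (cons_mem_support_of_mem_support_formalDeriv hm')
        · have : evalWords X S (formalDeriv p (e p) f) = D p (evalWords X S f) := by
            rw [evalWords_formalDeriv, evalWords_eq_sum, map_sum]
            refine Finset.sum_congr rfl fun m hm => ?_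
            rw [hDe p m.toList (f m) (by simpa using hmax m hm)]
            have hp : (m.toList.erase p).Perm (m.erase p).toList := by
              rw [← Multiset.coe_eq_coe, ← Multiset.coe_erase, Multiset.coe_toList,
                Multiset.coe_toList]
            rw [hperm hp, ← Multiset.coe_count, Multiset.coe_toList]
          rw [this]
          exact hW p _ hfW
      · push Not at hne
        exact ih f hf (fun m hm => by simp [hne m hm]) hfW
  obtain ⟨n, hn⟩ := exists_mem_wordSpan hwX
  obtain ⟨f, hf, rfl⟩ := wordSpan_le_map_evalWords
    (fun i j n y _ => by rw [hX i j, sub_self]; exact Submodule.zero_mem _) n hn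
  refine key n f (fun h => h0 (by rw [h, map_zero])) (fun m hm => ?_) hw
  exact le_of_lt ((Finsupp.mem_supported K f).1 hf hm)

end Words

/-! ### Commutation relations that produce derivatives. -/

section Lowering

variable {K M : Type*} [Field K] [CharZero K] [AddCommGroup M] [Module K M]
  {X : ℕ → Module.End K M} {S : Submodule K M}

/-- Lowering for commuting operators `X_i`: here `D_p` commutes with `X_i` for `i < p`, and its
commutator with `X_p` is `E_p`, which commutes with all the `X_i` and is injective on `S`. -/
theorem exists_mem_of_commuting_lowering (hX : ∀ i j y, X i (X j y) = X j (X i y))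
    (D E : ℕ → Module.End K M) (hES : ∀ p, ∀ s ∈ S, E p s ∈ S)
    (hE : ∀ p, ∀ s ∈ S, E p s = 0 → s = 0) (hEX : ∀ p i y, E p (X i y) = X i (E p y))
    (hDS : ∀ p, ∀ s ∈ S, D p s = 0)
    (hDlt : ∀ p i, i < p → ∀ w ∈ wordClosure X S, D p (X i w) = X i (D p w))
    (hDp : ∀ p, ∀ w ∈ wordClosure X S, D p (X p w) = X p (D p w) + E p w)
    (W : Submodule K M) (hW : ∀ p, ∀ w ∈ W, D p w ∈ W) {w : M} (hw : w ∈ W) (h0 : w ≠ 0)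
    (hwX : w ∈ wordClosure X S) : ∃ s ∈ S, s ≠ 0 ∧ s ∈ W := by
  have hperm : ∀ {l l' : List ℕ}, l.Perm l' → ∀ s, (l.map X).prod s = (l'.map X).prod s := by
    intro l l' h s
    induction h with
    | nil => rfl
    | cons i _ ih => simp [ih]
    | swap i j l => simp [hX i j]
    | trans _ _ ih₁ ih₂ => exact ih₁.trans ih₂
  have hEl : ∀ p (l : List ℕ) s, E p ((l.map X).prod s) = (l.map X).prod (E p s) := by
    intro p l s
    induction l with
    | nil => rfl
    | cons i l ih => simp [hEX, ih]
  refine exists_mem_of_exact_lowering hX D (fun p => (E p).restrict (hES p))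
    (fun p s h => Subtype.ext (hE p s s.2 (congrArg Subtype.val h))) ?_ W hW hw h0 hwX
  intro p l s hl
  induction l with
  | nil => simpa using hDS p s s.2
  | cons i l ih =>
    have ih' := ih fun j hj => hl j (List.mem_cons_of_mem _ hj)
    rw [LinearMap.coe_restrict_apply] at ih' ⊢
    rw [List.map_cons, List.prod_cons, Module.End.mul_apply]
    rcases (hl i List.mem_cons_self).lt_or_eq with h | rfl
    · rw [hDlt p i h _ (prod_mem_wordClosure l s.2), ih', List.count_cons_of_ne h.ne,
        List.erase_cons_tail (by simpa using h.ne), map_nsmul, List.map_cons, List.prod_cons,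
        Module.End.mul_apply]
    -- Product rule: the first letter contributes the word l with coefficient E_p s, the rest
    -- contributes count many terms.
    · rw [hDp i _ (prod_mem_wordClosure l s.2), ih', hEl, List.count_cons_self,
        List.erase_cons_head, map_nsmul, succ_nsmul]
      congr 1
      -- If i occurs in l, then X_i restores the erased letter; otherwise both sides carry the
      -- factor count = 0.
      by_cases hi : i ∈ l
      · rw [hperm (List.perm_cons_erase hi), List.map_cons, List.prod_cons, Module.End.mul_apply]
      · rw [List.count_eq_zero_of_not_mem hi, zero_smul, zero_smul]

/-- Lowering for operators `X_i` with `[X_i, X_j]` proportional to `X_{i+j+1}`, by means of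
operators `E_n` with `[E_n, X_i]` proportional to `E_{n-1-i}` such that `E_n` annihilates `S` for
`n > k` and `E_k` is injective on `S`. -/
theorem exists_mem_of_graded_lowering (b : ℕ → ℕ → K)
    (hX : ∀ i j y, X i (X j y) = X j (X i y) + b i j • X (i + j + 1) y)
    (E : ℤ → Module.End K M) (c : ℤ → ℕ → K)
    (hEX : ∀ n i y, E n (X i y) = X i (E n y) + c n i • E (n - 1 - i) y) (k : ℤ)
    (hc : ∀ p : ℕ, c (k + 1 + p) p ≠ 0) (hES : ∀ n, ∀ s ∈ S, E n s ∈ S)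
    (hE0 : ∀ n, k < n → ∀ s ∈ S, E n s = 0) (hEk : ∀ s ∈ S, E k s = 0 → s = 0)
    (W : Submodule K M) (hW : ∀ n, k < n → ∀ w ∈ W, E n w ∈ W) {w : M} (hw : w ∈ W) (h0 : w ≠ 0)
    (hwX : w ∈ wordClosure X S) : ∃ s ∈ S, s ≠ 0 ∧ s ∈ W := by
  -- Each commutator of E_n with a letter replaces that letter by a multiple of another E, so the
  -- error loses a letter.
  have hEl : ∀ (l : List ℕ) n, ∀ s ∈ S,
      E n ((l.map X).prod s) - (l.map X).prod (E n s) ∈ wordSpan X S l.length := by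
    intro l
    induction l with
    | nil => intro n s hs; simp
    | cons i l ih =>
      intro n s hs
      simp only [List.map_cons, List.prod_cons, Module.End.mul_apply, hEX, List.length_cons]
      have h₁ := apply_mem_wordSpan i (ih n s hs)
      have h₂ := Submodule.add_mem _ (wordSpan_mono (Nat.le_succ _) (ih (n - 1 - i) s hs))
        (prod_mem_wordSpan (Nat.lt_succ_self l.length) (hES (n - 1 - i) s hs))
      rw [sub_add_cancel] at h₂
      have h₃ := Submodule.add_mem _ h₁ (Submodule.smul_mem _ (c n i) h₂)
      rw [map_sub] at h₃
      convert h₃ using 1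
      abel
  refine exists_mem_of_lowering ?_ (fun p => E (k + 1 + p))
    (fun p => c (k + 1 + p) p • (E k).restrict (hES k)) ?_ ?_ ?_ W
    (fun p => hW _ (by omega)) hw h0 hwX
  · intro i j n y hy
    rw [hX i j, add_sub_cancel_left]
    exact Submodule.smul_mem _ _ (apply_mem_wordSpan _ hy)
  · intro p s h
    have h' : c (k + 1 + p) p • (E k).restrict (hES k) s = 0 := h
    rcases smul_eq_zero.1 h' with h | h
    · exact absurd h (hc p)
    · exact Subtype.ext (hEk s s.2 (congrArg Subtype.val h))
  · intro p n y hy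
    -- For index above k the main term E s is zero and only the shorter words remain.
    have : wordSpan X S (n + 1) ≤ (wordSpan X S n).comap (E (k + 1 + p)) := by
      refine wordSpan_le fun l hl s hs => ?_
      have h := hEl l (k + 1 + p) s hs
      rw [hE0 _ (by omega) s hs, map_zero, sub_zero] at h
      exact wordSpan_mono (Nat.lt_succ_iff.1 hl) h
    exact this hy
  · intro p l s hl
    simp only [LinearMap.smul_apply, Submodule.coe_smul, LinearMap.coe_restrict_apply]
    have hEks := hES k s s.2
    induction l with
    | nil => simp [hE0 (k + 1 + p) (by omega) s s.2]
    | cons i l ih =>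
      have ih' := ih fun j hj => hl j (List.mem_cons_of_mem _ hj)
      simp only [List.map_cons, List.prod_cons, Module.End.mul_apply, hEX, List.length_cons,
        Nat.add_sub_cancel]
      have hstep : X i (E (k + 1 + p) ((l.map X).prod s)) -
          l.count p • X i (((l.erase p).map X).prod (c (k + 1 + p) p • E k s)) ∈
            wordSpan X S l.length := by
        -- The bound `l.length - 1` is truncated at 0, so applying X_i to `ih'` gives the bound
        -- `l.length` only for nonempty l.
        rcases l with _ | ⟨j, l⟩
        · simp [hE0 (k + 1 + p) (by omega) s s.2]
        · have := apply_mem_wordSpan i ih'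
          rw [map_sub, map_nsmul] at this
          exact this
      have hE' := hEl l (k + 1 + p - 1 - i) s s.2
      -- The commutator with X_i involves E_{k+p-i}: for i < p it kills S and leaves shorter words,
      -- for i = p it is E_k.
      rcases (hl i List.mem_cons_self).lt_or_eq with h | rfl
      · rw [hE0 (k + 1 + p - 1 - i) (by omega) s s.2, map_zero, sub_zero] at hE'
        rw [List.count_cons_of_ne h.ne, List.erase_cons_tail (by simpa using h.ne), List.map_cons,
          List.prod_cons, Module.End.mul_apply, add_sub_right_comm]
        exact Submodule.add_mem _ hstep (Submodule.smul_mem _ _ hE')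
      · rw [show k + 1 + (i : ℤ) - 1 - i = k by ring] at hE' ⊢
        rw [List.count_cons_self, List.erase_cons_head, succ_nsmul]
        have hperm : l.count i • X i (((l.erase i).map X).prod (c (k + 1 + i) i • E k s)) -
            l.count i • (l.map X).prod (c (k + 1 + i) i • E k s) ∈ wordSpan X S l.length := by
          by_cases hi : i ∈ l
          · rw [← smul_sub]
            refine Submodule.smul_of_tower_mem _ _ ?_
            have := prod_sub_prod_mem_wordSpan_of_perm (X := X) (S := S) (fun i j n y hy => by
              rw [hX i j, add_sub_cancel_left]
              exact Submodule.smul_mem _ _ (apply_mem_wordSpan _ hy))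
              (List.perm_cons_erase hi).symm (S.smul_mem (c (k + 1 + i) i) hEks)
            rw [← (List.perm_cons_erase hi).length_eq] at this
            simpa using this
          · rw [List.count_eq_zero_of_not_mem hi, zero_smul, zero_smul, sub_zero]
            exact Submodule.zero_mem _
        have h₁ := Submodule.add_mem _ (Submodule.add_mem _ hstep hperm)
          (Submodule.smul_mem _ (c (k + 1 + i) i) hE')
        rw [smul_sub, ← map_smul ((l.map X).prod)] at h₁
        convert h₁ using 1
        abel

end Lowering

/-! ### Words in Lie algebra elements. -/

section LieWords

variable {K 𝔤 M : Type*} [Field K] [LieRing 𝔤] [LieAlgebra K 𝔤] [AddCommGroup M] [Module K M]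
  [LieRingModule 𝔤 M] [LieModule K 𝔤 M] {x : ℕ → 𝔤} {S : Submodule K M}

/-- If `A` preserves `S` and `[A, x_i]` lies in the span of `A` and the `x_j`, then the words in
the `x_i` over `S` are stable under `A` and the `x_i`. -/
theorem lie_mem_wordClosure (A : Submodule K 𝔤) (hS : ∀ a ∈ A, ∀ s ∈ S, ⁅a, s⁆ ∈ S)
    (hA : ∀ a ∈ A, ∀ i, ⁅a, x i⁆ ∈ A ⊔ Submodule.span K (Set.range x)) {a : 𝔤}
    (ha : a ∈ A ⊔ Submodule.span K (Set.range x)) {w : M}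
    (hw : w ∈ wordClosure (fun i => LieModule.toEnd K 𝔤 M (x i)) S) :
    ⁅a, w⁆ ∈ wordClosure (fun i => LieModule.toEnd K 𝔤 M (x i)) S := by
  set C := wordClosure (fun i => LieModule.toEnd K 𝔤 M (x i)) S with hC
  have hspan : ∀ a ∈ Submodule.span K (Set.range x), ∀ w ∈ C, ⁅a, w⁆ ∈ C := by
    intro a ha w hw
    induction ha using Submodule.span_induction with
    | mem a ha => obtain ⟨i, rfl⟩ := ha; exact apply_mem_wordClosure i hw
    | zero => rw [zero_lie]; exact C.zero_mem
    | add a b _ _ ha hb => rw [add_lie]; exact C.add_mem ha hb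
    | smul r a _ ha => rw [smul_lie]; exact C.smul_mem r ha
  -- The element a stays universally quantified in the induction, because [a, x_i] has a component
  -- in A different from a.
  have hword : ∀ l : List ℕ, ∀ s ∈ S, ∀ a ∈ A,
      ⁅a, (l.map fun i => LieModule.toEnd K 𝔤 M (x i)).prod s⁆ ∈ C := by
    intro l s hs
    induction l with
    | nil => intro a ha; exact subset_wordClosure (hS a ha s hs)
    | cons i l ih =>
      intro a ha
      rw [List.map_cons, List.prod_cons, Module.End.mul_apply, LieModule.toEnd_apply_apply,
        leibniz_lie]
      refine C.add_mem ?_ (apply_mem_wordClosure i (ih a ha))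
      obtain ⟨a', ha', b, hb, hab⟩ := Submodule.mem_sup.1 (hA a ha i)
      rw [← hab, add_lie]
      exact C.add_mem (ih a' ha') (hspan b hb _ (prod_mem_wordClosure l hs))
  obtain ⟨a', ha', b, hb, rfl⟩ := Submodule.mem_sup.1 ha
  rw [add_lie]
  refine C.add_mem ?_ (hspan b hb w hw)
  have : C ≤ C.comap (LieModule.toEnd K 𝔤 M a') := wordClosure_le fun l s hs => hword l s hs a' ha'
  exact this hw

/-- An element which commutes with the `x_i` and acts on `S` by a scalar acts by this scalar on
the words in the `x_i` over `S`. -/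
theorem lie_eq_smul_of_mem_wordClosure {a : 𝔤} {r : K} (hS : ∀ s ∈ S, ⁅a, s⁆ = r • s)
    (ha : ∀ i, ⁅a, x i⁆ = 0) {w : M}
    (hw : w ∈ wordClosure (fun i => LieModule.toEnd K 𝔤 M (x i)) S) : ⁅a, w⁆ = r • w := by
  have : wordClosure (fun i => LieModule.toEnd K 𝔤 M (x i)) S ≤
      LinearMap.eqLocus (LieModule.toEnd K 𝔤 M a) (r • LinearMap.id) := by
    refine wordClosure_le fun l s hs => ?_
    rw [LinearMap.mem_eqLocus, LieModule.toEnd_apply_apply]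
    induction l with
    | nil => exact hS s hs
    | cons i l ih =>
      rw [List.map_cons, List.prod_cons, Module.End.mul_apply, LieModule.toEnd_apply_apply,
        leibniz_lie, ha, zero_lie, zero_add, ih]
      simp
  exact this hw

end LieWords

/-! ### Brackets, and the subalgebra opposite to the parabolic one. -/

namespace EHV

section Brackets

variable (α β : ℂ)

theorem lie_L_L (m n : ℤ) : ⁅L α β 0 m, L α β 0 n⁆ = ((m : ℂ) - n) • L α β 0 (m + n) +
    (if m + n = 0 then ((m : ℂ) ^ 3 - m) / 12 else 0) • C₁ α β 0 :=
  lie_basis α β 0 (.L m) (.L n)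

theorem lie_L_G (m n : ℤ) :
    ⁅L α β 0 m, G α β 0 n⁆ = (-(α + n + m * β)) • G α β 0 (m + n) :=
  lie_basis α β 0 (.L m) (.G n)

theorem lie_G_L (n m : ℤ) : ⁅G α β 0 n, L α β 0 m⁆ = (α + n + m * β) • G α β 0 (m + n) :=
  lie_basis α β 0 (.G n) (.L m)

theorem lie_J_J (m n : ℤ) :
    ⁅J α β 0 m, J α β 0 n⁆ = (if m + n = 0 then (m : ℂ) else 0) • C₃ α β 0 :=
  lie_basis α β 0 (.J m) (.J n)

theorem lie_J_G (m n : ℤ) : ⁅J α β 0 m, G α β 0 n⁆ = 0 :=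
  (lie_basis α β 0 (.J m) (.G n)).trans (zero_smul _ _)

theorem lie_G_J (n m : ℤ) : ⁅G α β 0 n, J α β 0 m⁆ = 0 := by
  rw [← lie_skew, lie_J_G, neg_zero]

theorem lie_G_G (m n : ℤ) : ⁅G α β 0 m, G α β 0 n⁆ = 0 :=
  lie_basis α β 0 (.G m) (.G n)

theorem lie_C₃_J (m : ℤ) : ⁅C₃ α β 0, J α β 0 m⁆ = 0 := lie_basis α β 0 .C₃ (.J m)

theorem lie_C₃_G (m : ℤ) : ⁅C₃ α β 0, G α β 0 m⁆ = 0 := lie_basis α β 0 .C₃ (.G m)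

end Brackets

section Complement

variable (α β : ℂ) (d₁ d₂ : ℕ)

/-- The subalgebra spanned by the basis vectors outside `parabolic α β d₁ d₂`. -/
noncomputable def oppositeParabolic : LieSubalgebra ℂ (EHV α β 0) where
  toSubmodule := Submodule.span ℂ (basis α β 0 '' (parabolicIndex d₁ d₂)ᶜ)
  lie_mem' := by
    intro x y hx hy
    simp only [AddSubsemigroup.mem_carrier, AddSubmonoid.mem_toSubsemigroup,
      Submodule.mem_toAddSubmonoid] at hx hy ⊢
    refine Submodule.span_induction₂ (p := fun x y _ _ =>
      ⁅x, y⁆ ∈ Submodule.span ℂ (basis α β 0 '' (parabolicIndex d₁ d₂)ᶜ)) ?_ ?_ ?_ ?_ ?_ ?_ ?_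
      hx hy
    · rintro _ _ ⟨a, ha, rfl⟩ ⟨b, hb, rfl⟩
      rw [lie_basis]
      have key : ∀ c ∈ (parabolicIndex d₁ d₂)ᶜ, ∀ t : ℂ, t • basis α β 0 c ∈
          Submodule.span ℂ (basis α β 0 '' (parabolicIndex d₁ d₂)ᶜ) := fun c hc t =>
        Submodule.smul_mem _ t (Submodule.subset_span ⟨c, hc, rfl⟩)
      rcases a with m | m | m | _ | _ | _ <;> rcases b with n | n | n | _ | _ | _ <;>
        simp only [parabolicIndex, Set.mem_compl_iff, Set.mem_ofPred_eq, not_le,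
          not_true_eq_false] at ha hb
      all_goals simp only [basisBracket, neg_zero, zero_smul, Submodule.zero_mem]
      all_goals
        -- Both indices are negative, so they cannot sum to zero and no central term appears.
        try rw [if_neg (by omega), zero_smul]
        try simp only [add_zero, sub_zero, Submodule.zero_mem]
      all_goals exact key _ (by
        simp only [parabolicIndex, Set.mem_compl_iff, Set.mem_ofPred_eq]; omega) _
    · intro y _
      simp
    · intro x _
      simp
    · intro x y z _ _ _ h₁ h₂
      rw [add_lie]
      exact Submodule.add_mem _ h₁ h₂
    · intro x y z _ _ _ h₁ h₂
      rw [lie_add]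
      exact Submodule.add_mem _ h₁ h₂
    · intro r x y _ _ h
      rw [smul_lie]
      exact Submodule.smul_mem _ r h
    · intro r x y _ _ h
      rw [lie_smul]
      exact Submodule.smul_mem _ r h

theorem isCompl_oppositeParabolic : IsCompl (oppositeParabolic α β d₁ d₂).toSubmodule
    (parabolic α β d₁ d₂).toSubmodule := by
  constructor
  · exact (basis α β 0).linearIndependent.disjoint_span_image disjoint_compl_left
  · rw [codisjoint_iff]
    change Submodule.span ℂ _ ⊔ Submodule.span ℂ _ = ⊤
    rw [← Submodule.span_union, ← Set.image_union, Set.compl_union_self, Set.image_univ,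
      Module.Basis.span_eq]

end Complement

/-! ### The three layers of words and the elimination of each. -/

section Lowering

variable {α β : ℂ} {M : Type*} [AddCommGroup M] [Module ℂ M] [LieRingModule (EHV α β 0) M]
  [LieModule ℂ (EHV α β 0) M] {S : Submodule ℂ M}

variable (α β S) in
/-- The words in the `G_n` with `n < -d` over `S`. -/
noncomputable def wordsG (d : ℕ) : Submodule ℂ M :=
  wordClosure (fun i : ℕ => LieModule.toEnd ℂ (EHV α β 0) M (G α β 0 (-d - 1 - i))) S

variable (α β S) in
/-- The words in the `J_n` with `n < -d` over `S`. -/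
noncomputable def wordsJ (d : ℕ) : Submodule ℂ M :=
  wordClosure (fun i : ℕ => LieModule.toEnd ℂ (EHV α β 0) M (J α β 0 (-d - 1 - i))) S

variable (α β S) in
/-- The words in the `L_n` with `n < 0` over `S`. -/
noncomputable def wordsL : Submodule ℂ M :=
  wordClosure (fun i : ℕ => LieModule.toEnd ℂ (EHV α β 0) M (L α β 0 (-1 - i))) S

/-- The words in the basis vectors `x_i` over `S` are stable under `I` and the `x_i`, provided `I`
preserves `S` and `[I, x_i]` lies in the span of `I` and the `x_j`. -/
theorem lie_basis_mem_wordClosure {I I' : Set EHVIndex} {x : ℕ → EHVIndex}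
    (hI : I' ⊆ I ∪ Set.range x) (hS : ∀ a ∈ I, ∀ s ∈ S, ⁅basis α β 0 a, s⁆ ∈ S)
    (hx : ∀ a ∈ I, ∀ i, basisBracket α β 0 a (x i) ∈
      Submodule.span ℂ (basis α β 0 '' (I ∪ Set.range x))) {a : EHVIndex} (ha : a ∈ I') {w : M}
    (hw : w ∈ wordClosure (fun i => LieModule.toEnd ℂ (EHV α β 0) M (basis α β 0 (x i))) S) :
    ⁅basis α β 0 a, w⁆ ∈
      wordClosure (fun i => LieModule.toEnd ℂ (EHV α β 0) M (basis α β 0 (x i))) S := by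
  have hsup : Submodule.span ℂ (basis α β 0 '' I) ⊔
      Submodule.span ℂ (Set.range fun i => basis α β 0 (x i)) =
      Submodule.span ℂ (basis α β 0 '' (I ∪ Set.range x)) := by
    rw [← Submodule.span_union, Set.image_union, ← Set.range_comp]
    rfl
  refine lie_mem_wordClosure (x := fun i => basis α β 0 (x i))
    (Submodule.span ℂ (basis α β 0 '' I)) ?_ ?_ ?_ hw
  · intro a ha s hs
    induction ha using Submodule.span_induction with
    | mem a ha => obtain ⟨b, hb, rfl⟩ := ha; exact hS b hb s hs
    | zero => rw [zero_lie]; exact S.zero_mem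
    | add a b _ _ ha hb => rw [add_lie]; exact S.add_mem ha hb
    | smul r a _ ha => rw [smul_lie]; exact S.smul_mem r ha
  · intro a ha i
    rw [hsup]
    induction ha using Submodule.span_induction with
    | mem a ha => obtain ⟨b, hb, rfl⟩ := ha; rw [lie_basis]; exact hx b hb i
    | zero => rw [zero_lie]; exact Submodule.zero_mem _
    | add a b _ _ ha hb => rw [add_lie]; exact Submodule.add_mem _ ha hb
    | smul r a _ ha => rw [smul_lie]; exact Submodule.smul_mem _ r ha
  · rw [hsup]
    exact Submodule.subset_span ⟨a, hI ha, rfl⟩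

/-- The labels of `L_i` (`i ≥ 0`), `J_{-d+i}` (`i ≥ 0`), all `G_m` and the central elements. -/
def indexAddG (d : ℕ) : Set EHVIndex :=
  {a | match a with
    | .L m => 0 ≤ m
    | .J m => -(d : ℤ) ≤ m
    | _ => True}

/-- The labels of `L_i` (`i ≥ 0`), all `J_m`, all `G_m` and the central elements. -/
def indexAddJ : Set EHVIndex :=
  {a | match a with
    | .L m => 0 ≤ m
    | _ => True}

theorem mem_parabolicIndex_union_range {d₁ d₂ : ℕ} {a : EHVIndex} (ha : a ∈ indexAddG d₂) :
    a ∈ parabolicIndex d₁ d₂ ∪ Set.range fun i : ℕ => EHVIndex.G (-d₁ - 1 - i) := by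
  rcases a with m | m | m | _ | _ | _
  case G =>
    by_cases h : -(d₁ : ℤ) ≤ m
    · exact Or.inl h
    · exact Or.inr ⟨(-d₁ - 1 - m).toNat, by simp only [EHVIndex.G.injEq]; omega⟩
  all_goals exact Or.inl ha

theorem mem_indexAddG_union_range {d : ℕ} {a : EHVIndex} (ha : a ∈ indexAddJ) :
    a ∈ indexAddG d ∪ Set.range fun i : ℕ => EHVIndex.J (-d - 1 - i) := by
  rcases a with m | m | m | _ | _ | _
  case J =>
    by_cases h : -(d : ℤ) ≤ m
    · exact Or.inl h
    · exact Or.inr ⟨(-d - 1 - m).toNat, by simp only [EHVIndex.J.injEq]; omega⟩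
  all_goals exact Or.inl ha

theorem mem_indexAddJ_union_range (a : EHVIndex) :
    a ∈ indexAddJ ∪ Set.range fun i : ℕ => EHVIndex.L (-1 - i) := by
  rcases a with m | m | m | _ | _ | _
  case L =>
    by_cases h : 0 ≤ m
    · exact Or.inl h
    · exact Or.inr ⟨(-1 - m).toNat, by simp only [EHVIndex.L.injEq]; omega⟩
  all_goals exact Or.inl trivial

/-- The span of all G_m is an ideal, so moving an element past a letter produces a multiple of some
G_m, which is again a letter or parabolic. -/
theorem lie_mem_wordsG {d₁ d₂ : ℕ}
    (hS : ∀ a ∈ parabolicIndex d₁ d₂, ∀ s ∈ S, ⁅basis α β 0 a, s⁆ ∈ S) {a : EHVIndex}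
    (ha : a ∈ indexAddG d₂) {w : M} (hw : w ∈ wordsG α β S d₁) :
    ⁅basis α β 0 a, w⁆ ∈ wordsG α β S d₁ := by
  refine lie_basis_mem_wordClosure (I := parabolicIndex d₁ d₂) (I' := indexAddG d₂)
    (x := fun i : ℕ => .G (-d₁ - 1 - i)) (fun _ => mem_parabolicIndex_union_range) hS ?_ ha hw
  intro a ha i
  have key : ∀ n, ∀ t : ℂ, t • G α β 0 n ∈ Submodule.span ℂ (basis α β 0 ''
      (parabolicIndex d₁ d₂ ∪ Set.range fun i : ℕ => EHVIndex.G (-d₁ - 1 - i))) := fun n t =>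
    Submodule.smul_mem _ t (Submodule.subset_span
      ⟨.G n, mem_parabolicIndex_union_range (a := .G n) trivial, rfl⟩)
  rcases a with m | m | m | _ | _ | _ <;> simp only [basisBracket, Submodule.zero_mem]
  all_goals exact key _ _

/-- Moving L_m, J_m or a G past a letter J_n yields only J's and central elements, or zero. -/
theorem lie_mem_wordsJ {d : ℕ}
    (hS : ∀ a ∈ indexAddG d, ∀ s ∈ S, ⁅basis α β 0 a, s⁆ ∈ S) {a : EHVIndex}
    (ha : a ∈ indexAddJ) {w : M} (hw : w ∈ wordsJ α β S d) :
    ⁅basis α β 0 a, w⁆ ∈ wordsJ α β S d := by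
  refine lie_basis_mem_wordClosure (I := indexAddG d) (I' := indexAddJ)
    (x := fun i : ℕ => .J (-d - 1 - i)) (fun _ => mem_indexAddG_union_range) hS ?_ ha hw
  intro a ha i
  have key : ∀ c ∈ indexAddJ, ∀ t : ℂ, t • basis α β 0 c ∈ Submodule.span ℂ (basis α β 0 ''
      (indexAddG d ∪ Set.range fun i : ℕ => EHVIndex.J (-d - 1 - i))) := fun c hc t =>
    Submodule.smul_mem _ t (Submodule.subset_span ⟨c, mem_indexAddG_union_range hc, rfl⟩)
  rcases a with m | m | m | _ | _ | _ <;> simp only [basisBracket, Submodule.zero_mem]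
  · exact Submodule.sub_mem _ (key (.J _) trivial _) (key .C₂ trivial _)
  · exact key .C₃ trivial _
  · exact key (.G _) trivial _

theorem lie_mem_wordsL (hS : ∀ a ∈ indexAddJ, ∀ s ∈ S, ⁅basis α β 0 a, s⁆ ∈ S) (x : EHV α β 0)
    {w : M} (hw : w ∈ wordsL α β S) : ⁅x, w⁆ ∈ wordsL α β S := by
  have hbasis : ∀ a, ⁅basis α β 0 a, w⁆ ∈ wordsL α β S := by
    intro a
    refine lie_basis_mem_wordClosure (I := indexAddJ) (I' := Set.univ)
      (x := fun i : ℕ => .L (-1 - i)) (fun a _ => mem_indexAddJ_union_range a) hS ?_ trivial hw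
    intro a ha i
    have key : ∀ c, ∀ t : ℂ, t • basis α β 0 c ∈ Submodule.span ℂ (basis α β 0 ''
        (indexAddJ ∪ Set.range fun i : ℕ => EHVIndex.L (-1 - i))) := fun c t =>
      Submodule.smul_mem _ t (Submodule.subset_span ⟨c, mem_indexAddJ_union_range c, rfl⟩)
    rcases a with m | m | m | _ | _ | _ <;> simp only [basisBracket, Submodule.zero_mem]
    · exact Submodule.add_mem _ (key (.L _) _) (key .C₁ _)
    · exact Submodule.add_mem _ (key (.J _) _) (key .C₂ _)
    · exact key (.G _) _
  have hx : x ∈ Submodule.span ℂ (Set.range (basis α β 0)) := by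
    rw [Module.Basis.span_eq]; trivial
  induction hx using Submodule.span_induction with
  | mem x hx => obtain ⟨a, rfl⟩ := hx; exact hbasis a
  | zero => rw [zero_lie]; exact Submodule.zero_mem _
  | add a b _ _ ha hb => rw [add_lie]; exact Submodule.add_mem _ ha hb
  | smul r a _ ha => rw [smul_lie]; exact Submodule.smul_mem _ r ha

theorem lie_G_wordsG {d : ℕ} {n : ℤ} (h : ∀ s ∈ S, ⁅G α β 0 n, s⁆ = 0) {w : M}
    (hw : w ∈ wordsG α β S d) : ⁅G α β 0 n, w⁆ = 0 := by
  have := lie_eq_smul_of_mem_wordClosure (r := (0 : ℂ)) (a := G α β 0 n)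
    (fun s hs => by rw [h s hs, zero_smul]) (fun i => lie_G_G α β _ _) hw
  rwa [zero_smul] at this

theorem lie_G_wordsJ {d : ℕ} {n : ℤ} (h : ∀ s ∈ S, ⁅G α β 0 n, s⁆ = 0) {w : M}
    (hw : w ∈ wordsJ α β S d) : ⁅G α β 0 n, w⁆ = 0 := by
  have := lie_eq_smul_of_mem_wordClosure (r := (0 : ℂ)) (a := G α β 0 n)
    (fun s hs => by rw [h s hs, zero_smul]) (fun i => lie_G_J α β _ _) hw
  rwa [zero_smul] at this

theorem lie_J_wordsG {d : ℕ} {n : ℤ} (h : ∀ s ∈ S, ⁅J α β 0 n, s⁆ = 0) {w : M}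
    (hw : w ∈ wordsG α β S d) : ⁅J α β 0 n, w⁆ = 0 := by
  have := lie_eq_smul_of_mem_wordClosure (r := (0 : ℂ)) (a := J α β 0 n)
    (fun s hs => by rw [h s hs, zero_smul]) (fun i => lie_J_G α β _ _) hw
  rwa [zero_smul] at this

/-- Elimination of the `G_n` with `n < -d`. -/
theorem exists_mem_of_mem_wordsG
    (hαβ : ∀ m n : ℤ, m ≠ 0 → n ≠ 0 → α + (n : ℂ) + (m : ℂ) * β ≠ 0) (d k : ℕ)
    (hGk : ∀ s ∈ S, ⁅G α β 0 k, s⁆ ∈ S) (hGinj : ∀ s ∈ S, ⁅G α β 0 k, s⁆ = 0 → s = 0)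
    (hG : ∀ n : ℤ, k < n → ∀ s ∈ S, ⁅G α β 0 n, s⁆ = 0)
    (hL : ∀ n : ℤ, k + d < n → ∀ s ∈ S, ⁅L α β 0 n, s⁆ = 0)
    (W : Submodule ℂ M) (hW : ∀ n : ℤ, k + d < n → ∀ w ∈ W, ⁅L α β 0 n, w⁆ ∈ W) {w : M}
    (hw : w ∈ W) (h0 : w ≠ 0) (hwG : w ∈ wordsG α β S d) :
    ∃ s ∈ S, s ≠ 0 ∧ s ∈ W := by
  let c : ℕ → ℂ := fun p => -(α + ((-d - 1 - p : ℤ) : ℂ) + ((k + d + 1 + p : ℤ) : ℂ) * β)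
  -- The condition on α, β applies because k+d+1+p > 0 and -d-1-p < 0.
  have hc : ∀ p, c p ≠ 0 := fun p => neg_ne_zero.2 (hαβ _ _ (by omega) (by omega))
  refine exists_mem_of_commuting_lowering ?_
    (fun p : ℕ => LieModule.toEnd ℂ (EHV α β 0) M (L α β 0 (k + d + 1 + p)))
    (fun p => c p • LieModule.toEnd ℂ (EHV α β 0) M (G α β 0 k)) ?_ ?_ ?_ ?_ ?_ ?_ W
    (fun p => hW _ (by omega)) hw h0 hwG
  · intro i j y
    simp only [LieModule.toEnd_apply_apply]
    rw [leibniz_lie, lie_G_G, zero_lie, zero_add]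
  · intro p s hs
    exact S.smul_mem _ (hGk s hs)
  · intro p s hs h
    exact hGinj s hs ((smul_eq_zero.1 h).resolve_left (hc p))
  · intro p i y
    simp only [LinearMap.smul_apply, LieModule.toEnd_apply_apply, lie_smul]
    rw [leibniz_lie, lie_G_G, zero_lie, zero_add]
  · intro p s hs
    exact hL _ (by omega) s hs
  · intro p i hi w hw
    simp only [LieModule.toEnd_apply_apply]
    -- The bracket is a multiple of G_{k+p-i} with p - i > 0, which kills all words in the G's.
    rw [leibniz_lie, lie_L_G, smul_lie, lie_G_wordsG (hG _ (by omega)) hw, smul_zero, zero_add]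
  · intro p w hw
    simp only [LieModule.toEnd_apply_apply, LinearMap.smul_apply]
    rw [leibniz_lie, lie_L_G, smul_lie, add_comm,
      show (k + d + 1 + p + (-d - 1 - p) : ℤ) = k by ring]

/-- Elimination of the `J_n` with `n < -d`. -/
theorem exists_mem_of_mem_wordsJ (d : ℕ) {ℓ : ℂ} (hℓ : ℓ ≠ 0)
    (hC : ∀ s ∈ S, ⁅C₃ α β 0, s⁆ = ℓ • s) (hJ : ∀ n : ℤ, d < n → ∀ s ∈ S, ⁅J α β 0 n, s⁆ = 0)
    (W : Submodule ℂ M) (hW : ∀ n : ℤ, d < n → ∀ w ∈ W, ⁅J α β 0 n, w⁆ ∈ W) {w : M}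
    (hw : w ∈ W) (h0 : w ≠ 0) (hwJ : w ∈ wordsJ α β S d) :
    ∃ s ∈ S, s ≠ 0 ∧ s ∈ W := by
  let c : ℕ → ℂ := fun p => ((d + 1 + p : ℤ) : ℂ) * ℓ
  have hc : ∀ p, c p ≠ 0 := fun p => mul_ne_zero (Int.cast_ne_zero.2 (by omega)) hℓ
  refine exists_mem_of_commuting_lowering ?_
    (fun p : ℕ => LieModule.toEnd ℂ (EHV α β 0) M (J α β 0 (d + 1 + p)))
    (fun p => c p • LinearMap.id) ?_ ?_ ?_ ?_ ?_ ?_ W (fun p => hW _ (by omega)) hw h0 hwJ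
  · intro i j y
    simp only [LieModule.toEnd_apply_apply]
    rw [leibniz_lie, lie_J_J, if_neg (by omega), zero_smul, zero_lie, zero_add]
  · intro p s hs
    exact S.smul_mem _ hs
  · intro p s hs h
    exact (smul_eq_zero.1 h).resolve_left (hc p)
  · intro p i y
    simp
  · intro p s hs
    exact hJ _ (by omega) s hs
  · intro p i hi w hw
    simp only [LieModule.toEnd_apply_apply]
    rw [leibniz_lie, lie_J_J, if_neg (by omega), zero_smul, zero_lie, zero_add]
  · intro p w hw
    have hCw : ⁅C₃ α β 0, w⁆ = ℓ • w :=
      lie_eq_smul_of_mem_wordClosure hC (fun i => lie_C₃_J α β _) hw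
    simp only [LieModule.toEnd_apply_apply, LinearMap.smul_apply, LinearMap.id_apply]
    rw [leibniz_lie, lie_J_J, if_pos (by ring), smul_lie, hCw, smul_smul, add_comm]

/-- Elimination of the `L_n` with `n < 0`. -/
theorem exists_mem_of_mem_wordsL
    (hαβ : ∀ m n : ℤ, m ≠ 0 → n ≠ 0 → α + (n : ℂ) + (m : ℂ) * β ≠ 0) (k : ℕ)
    (hGS : ∀ n, ∀ s ∈ S, ⁅G α β 0 n, s⁆ ∈ S) (hGinj : ∀ s ∈ S, ⁅G α β 0 k, s⁆ = 0 → s = 0)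
    (hG : ∀ n : ℤ, k < n → ∀ s ∈ S, ⁅G α β 0 n, s⁆ = 0)
    (W : Submodule ℂ M) (hW : ∀ n : ℤ, k < n → ∀ w ∈ W, ⁅G α β 0 n, w⁆ ∈ W) {w : M}
    (hw : w ∈ W) (h0 : w ≠ 0) (hwL : w ∈ wordsL α β S) :
    ∃ s ∈ S, s ≠ 0 ∧ s ∈ W := by
  refine exists_mem_of_graded_lowering
    (fun i j => ((-1 - i : ℤ) : ℂ) - ((-1 - j : ℤ) : ℂ)) ?_
    (fun n => LieModule.toEnd ℂ (EHV α β 0) M (G α β 0 n))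
    (fun n i => α + n + ((-1 - i : ℤ) : ℂ) * β) ?_ k ?_ hGS hG hGinj W hW hw h0 hwL
  · intro i j y
    simp only [LieModule.toEnd_apply_apply]
    rw [leibniz_lie, lie_L_L, if_neg (by omega), zero_smul, add_zero, smul_lie, add_comm]
    congr 4
    push_cast
    ring
  · intro n i y
    simp only [LieModule.toEnd_apply_apply]
    rw [leibniz_lie, lie_G_L, smul_lie, add_comm]
    congr 4
    ring
  -- The coefficient α + (k+1+p) + (-1-p)β, with both integers nonzero.
  · intro p
    exact hαβ _ _ (by omega) (by omega)

end Lowering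

end EHV

/-! ### Descent through the three layers. -/

namespace EHV

/-- Let `S` be a subspace of `M` stable under `parabolic α β d₁ d₂` on which `C₃` acts by a nonzero
scalar, `G_k` is injective, and `G_n` (`n > k`), `J_n` (`n > d₂`), `L_n` (`n > k + d₁`) vanish. If
`S` generates `M`, then every nonzero submodule of `M` meets `S` nontrivially. -/
theorem exists_mem_of_ne_bot {α β : ℂ} {M : Type*} [AddCommGroup M] [Module ℂ M]
    [LieRingModule (EHV α β 0) M] [LieModule ℂ (EHV α β 0) M] {S : Submodule ℂ M}
    (hαβ : ∀ m n : ℤ, m ≠ 0 → n ≠ 0 → α + (n : ℂ) + (m : ℂ) * β ≠ 0) {d₁ d₂ k : ℕ} {ℓ : ℂ}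
    (hℓ : ℓ ≠ 0) (hS : ∀ a ∈ parabolicIndex d₁ d₂, ∀ s ∈ S, ⁅basis α β 0 a, s⁆ ∈ S)
    (hC : ∀ s ∈ S, ⁅C₃ α β 0, s⁆ = ℓ • s) (hGinj : ∀ s ∈ S, ⁅G α β 0 k, s⁆ = 0 → s = 0)
    (hG : ∀ n : ℤ, k < n → ∀ s ∈ S, ⁅G α β 0 n, s⁆ = 0)
    (hJ : ∀ n : ℤ, d₂ < n → ∀ s ∈ S, ⁅J α β 0 n, s⁆ = 0)
    (hL : ∀ n : ℤ, k + d₁ < n → ∀ s ∈ S, ⁅L α β 0 n, s⁆ = 0)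
    (hgen : ∀ N : Submodule ℂ M, S ≤ N → (∀ x : EHV α β 0, ∀ w ∈ N, ⁅x, w⁆ ∈ N) → N = ⊤)
    {W : LieSubmodule ℂ (EHV α β 0) M} (hW : W ≠ ⊥) : ∃ s ∈ S, s ≠ 0 ∧ s ∈ W := by
  let S₁ : Submodule ℂ M := wordsG α β S d₁
  let S₂ : Submodule ℂ M := wordsJ α β S₁ d₂
  have h₁ : ∀ a ∈ indexAddG d₂, ∀ s ∈ S₁, ⁅basis α β 0 a, s⁆ ∈ S₁ :=
    fun a ha s hs => lie_mem_wordsG hS ha hs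
  have h₂ : ∀ a ∈ indexAddJ, ∀ s ∈ S₂, ⁅basis α β 0 a, s⁆ ∈ S₂ :=
    fun a ha s hs => lie_mem_wordsJ h₁ ha hs
  have htop : wordsL α β S₂ = ⊤ :=
    hgen _ (fun s hs => subset_wordClosure (subset_wordClosure (subset_wordClosure hs)))
      fun x w hw => lie_mem_wordsL h₂ x hw
  have hG₁ : ∀ n : ℤ, k < n → ∀ s ∈ S₁, ⁅G α β 0 n, s⁆ = 0 :=
    fun n hn s hs => lie_G_wordsG (hG n hn) hs
  have hG₂ : ∀ n : ℤ, k < n → ∀ s ∈ S₂, ⁅G α β 0 n, s⁆ = 0 :=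
    fun n hn s hs => lie_G_wordsJ (hG₁ n hn) hs
  have hJ₁ : ∀ n : ℤ, d₂ < n → ∀ s ∈ S₁, ⁅J α β 0 n, s⁆ = 0 :=
    fun n hn s hs => lie_J_wordsG (hJ n hn) hs
  have hC₁ : ∀ s ∈ S₁, ⁅C₃ α β 0, s⁆ = ℓ • s :=
    fun s hs => lie_eq_smul_of_mem_wordClosure hC (fun i => lie_C₃_G α β _) hs
  have hGk : ∀ s ∈ S, ⁅G α β 0 k, s⁆ ∈ S :=
    hS (.G k) (show -(d₁ : ℤ) ≤ k by omega)
  have hinj₁ : ∀ s ∈ S₁, ⁅G α β 0 k, s⁆ = 0 → s = 0 := by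
    intro s hs h
    by_contra h0
    -- [G_k, L_n] is a multiple of G_{k+n}, known to vanish on S₁ only; hence the intersection,
    -- which makes Z stable under these L_n. Descent then finds a nonzero vector of S killed by G_k.
    let Z := S₁ ⊓ LinearMap.ker (LieModule.toEnd ℂ (EHV α β 0) M (G α β 0 k))
    have hZ : ∀ n : ℤ, k + d₁ < n → ∀ w ∈ Z, ⁅L α β 0 n, w⁆ ∈ Z := by
      rintro n hn w ⟨hw, hwZ⟩
      refine ⟨h₁ (.L n) (show 0 ≤ n by omega) w hw, ?_⟩
      have hwZ' : ⁅G α β 0 k, w⁆ = 0 := hwZ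
      change ⁅G α β 0 k, ⁅L α β 0 n, w⁆⁆ = 0
      rw [leibniz_lie, lie_G_L, smul_lie, hG₁ _ (by omega) w hw, smul_zero, hwZ', lie_zero,
        add_zero]
    obtain ⟨v, hv, hv0, hvZ⟩ := exists_mem_of_mem_wordsG hαβ d₁ k hGk hGinj hG hL Z hZ
      (w := s) ⟨hs, h⟩ h0 hs
    exact hv0 (hGinj v hv hvZ.2)
  have hinj₂ : ∀ s ∈ S₂, ⁅G α β 0 k, s⁆ = 0 → s = 0 := by
    intro s hs h
    by_contra h0
    -- G_k commutes with every J_n, so the whole kernel is stable.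
    let Z := LinearMap.ker (LieModule.toEnd ℂ (EHV α β 0) M (G α β 0 k))
    have hZ : ∀ n : ℤ, d₂ < n → ∀ w ∈ Z, ⁅J α β 0 n, w⁆ ∈ Z := by
      intro n _ w hwZ
      have hwZ' : ⁅G α β 0 k, w⁆ = 0 := hwZ
      change ⁅G α β 0 k, ⁅J α β 0 n, w⁆⁆ = 0
      rw [leibniz_lie, lie_G_J, zero_lie, hwZ', lie_zero, add_zero]
    obtain ⟨v, hv, hv0, hvZ⟩ := exists_mem_of_mem_wordsJ d₂ hℓ hC₁ hJ₁ Z hZ (w := s) h h0 hs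
    exact hv0 (hinj₁ v hv hvZ)
  obtain ⟨w, hw, hw0⟩ : ∃ w ∈ W, w ≠ 0 := by
    by_contra! h
    exact hW ((LieSubmodule.eq_bot_iff W).2 h)
  obtain ⟨w₂, hw₂, hw₂0, hw₂W⟩ := exists_mem_of_mem_wordsL hαβ k
    (fun n => h₂ (.G n) trivial) hinj₂ hG₂ W.toSubmodule
    (fun n _ w hw => W.lie_mem hw) hw hw0 (htop ▸ Submodule.mem_top)
  obtain ⟨w₁, hw₁, hw₁0, hw₁W⟩ := exists_mem_of_mem_wordsJ d₂ hℓ hC₁ hJ₁ W.toSubmodule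
    (fun n _ w hw => W.lie_mem hw) hw₂W hw₂0 hw₂
  exact exists_mem_of_mem_wordsG hαβ d₁ k hGk hGinj hG hL W.toSubmodule
    (fun n _ w hw => W.lie_mem hw) hw₁W hw₁0 hw₁

end EHV

/-! ### Simplicity of the induced module. -/

theorem mainTheorem4 (α β : ℂ)
    (hαβ : ∀ m n : ℤ, m ≠ 0 → n ≠ 0 → α + (n : ℂ) + (m : ℂ) * β ≠ 0)
    (d₁ d₂ : ℕ) (V : Type*) [AddCommGroup V] [Module ℂ V]
    [LieRingModule (EHV.parabolic α β d₁ d₂) V] [LieModule ℂ (EHV.parabolic α β d₁ d₂) V]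
    (hV : LieModule.IsIrreducible ℂ (EHV.parabolic α β d₁ d₂) V)
    (ℓ₃ : ℂ) (hℓ₃ : ℓ₃ ≠ 0)
    (hC₃ : ∀ v : V,
      ⁅(⟨EHV.C₃ α β 0, EHV.C₃_mem_parabolic⟩ : EHV.parabolic α β d₁ d₂), v⁆ = ℓ₃ • v)
    (k : ℕ)
    (hGinj : Function.Injective fun v : V =>
      ⁅(⟨EHV.G α β 0 k, EHV.G_mem_parabolic (by omega)⟩ : EHV.parabolic α β d₁ d₂), v⁆)
    (hG : ∀ i : ℕ, 1 ≤ i → ∀ v : V,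
      ⁅(⟨EHV.G α β 0 (k + i), EHV.G_mem_parabolic (by omega)⟩ :
        EHV.parabolic α β d₁ d₂), v⁆ = 0)
    (hJ : ∀ i : ℕ, 1 ≤ i → ∀ v : V,
      ⁅(⟨EHV.J α β 0 (d₂ + i), EHV.J_mem_parabolic (by omega)⟩ :
        EHV.parabolic α β d₁ d₂), v⁆ = 0)
    (hL : ∀ i : ℕ, 1 ≤ i → ∀ v : V,
      ⁅(⟨EHV.L α β 0 (k + d₁ + i), EHV.L_mem_parabolic (by omega)⟩ :
        EHV.parabolic α β d₁ d₂), v⁆ = 0) :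
    LieModule.IsIrreducible ℂ (EHV α β 0) (LieModule.Ind (EHV.parabolic α β d₁ d₂) V) := by
  let 𝔥 := EHV.parabolic α β d₁ d₂
  let of := LieModule.Ind.of 𝔥 V
  have hinj : Function.Injective of :=
    LieModule.Ind.of_injective V (EHV.isCompl_oppositeParabolic α β d₁ d₂)
  have hof : ∀ (x : EHV α β 0) (hx : x ∈ 𝔥) (v : V), ⁅x, of v⁆ = of ⁅(⟨x, hx⟩ : 𝔥), v⁆ :=
    fun x hx v => LieModule.Ind.lie_of 𝔥 V ⟨x, hx⟩ v
  have hVn : Nontrivial V := LieModule.nontrivial_of_isIrreducible ℂ 𝔥 V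
  have : Nontrivial (LieModule.Ind 𝔥 V) := hinj.nontrivial
  refine LieModule.IsIrreducible.mk fun W hW => ?_
  -- If W meets the image of V, the preimage of W in V is a nonzero submodule, hence all of V.
  suffices h : ∃ s ∈ LinearMap.range of, s ≠ 0 ∧ s ∈ W by
    obtain ⟨_, ⟨v, rfl⟩, hs0, hsW⟩ := h
    let N : LieSubmodule ℂ 𝔥 V :=
      { W.toSubmodule.comap of with
        lie_mem := fun {y v} hv => by
          change of ⁅y, v⁆ ∈ W
          rw [show of ⁅y, v⁆ = ⁅(y : EHV α β 0), of v⁆ from (hof y y.2 v).symm]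
          exact W.lie_mem hv }
    have hN : N = ⊤ := (IsSimpleOrder.eq_bot_or_eq_top N).resolve_left fun h => by
      have hv : v ∈ N := hsW
      rw [h, LieSubmodule.mem_bot] at hv
      exact hs0 (by rw [hv, map_zero])
    have hNW : ∀ v, of v ∈ W := fun v => by
      have : v ∈ N := by rw [hN]; trivial
      exact this
    rw [← LieSubmodule.toSubmodule_inj]
    exact LieModule.Ind.eq_top_of_lie_mem 𝔥 V W.toSubmodule hNW fun x w hw => W.lie_mem hw
  refine EHV.exists_mem_of_ne_bot hαβ (d₁ := d₁) (d₂ := d₂) (k := k) hℓ₃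
    ?_ ?_ ?_ ?_ ?_ ?_ ?_ hW
  · rintro a ha _ ⟨v, rfl⟩
    rw [hof _ (Submodule.subset_span ⟨a, ha, rfl⟩)]
    exact LinearMap.mem_range_self _ _
  · rintro _ ⟨v, rfl⟩
    rw [hof _ EHV.C₃_mem_parabolic, hC₃, map_smul]
  · rintro _ ⟨v, rfl⟩ h
    rw [hof _ (EHV.G_mem_parabolic (by omega)), ← map_zero of] at h
    have hv : v = 0 := hGinj ((hinj h).trans (lie_zero _).symm)
    rw [hv, map_zero]
  · rintro n hn _ ⟨v, rfl⟩
    obtain ⟨i, rfl⟩ : ∃ i : ℕ, n = k + i := ⟨(n - k).toNat, by omega⟩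
    rw [hof _ (EHV.G_mem_parabolic (by omega)), hG i (by omega), map_zero]
  · rintro n hn _ ⟨v, rfl⟩
    obtain ⟨i, rfl⟩ : ∃ i : ℕ, n = d₂ + i := ⟨(n - d₂).toNat, by omega⟩
    rw [hof _ (EHV.J_mem_parabolic (by omega)), hJ i (by omega), map_zero]
  · rintro n hn _ ⟨v, rfl⟩
    obtain ⟨i, rfl⟩ : ∃ i : ℕ, n = k + d₁ + i := ⟨(n - (k + d₁)).toNat, by omega⟩
    rw [hof _ (EHV.L_mem_parabolic (by omega)), hL i (by omega), map_zero]
  · intro N hSN hN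
    exact LieModule.Ind.eq_top_of_lie_mem 𝔥 V N (fun v => hSN (LinearMap.mem_range_self _ v)) hN
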